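/- Let $p_1,p_2\ge 3$, $n=p_1+p_2$, let $V\subset\mathbb R^n$ be open (a coordinate domain of a locally conformally flat manifold), let $r\in\{2,3,\dots,\infty\}$, and let $\bar g=\delta_{AB}\,dx_A dx_B/F^2$ be a metric on $V$ with $F>0$ of class $C^r$. Let $D_1$ be spanned by the coordinate fields $\partial_i$, $i\le p_1$, and $D_2$ by the $\partial_\alpha$, $\alpha>p_1$. For a Riemannian metric $g$ with $D_1\perp D_2$ the partial Ricci curvatures are $\operatorname{Ric}_1(X,Y)=\sum_{\alpha} g(R(e_\alpha,X)Y,e_\alpha)$ and $\operatorname{Ric}_2(X,Y)=\sum_{i} g(R(e_i,X)Y,e_i)$, where $(e_\alpha)$ and $(e_i)$ are $g$-orthonormal frames of $D_2$ and of $D_1$. Let $T$ be a symmetric $(0,2)$-tensor on $V$ with components of class $C^1$, not diagonal on $V$ (some off-diagonal component is not identically zero), such that $T_{ij}=f_{ij}(x_i,x_j)$ for $i\ne j\le p_1$, $T_{\alpha\beta}=f_{\alpha\beta}(x_\alpha,x_\beta)$ for $\alpha\neq\beta>p_1$, and $T_{i\alpha}=0$; the diagonal components $T_{AA}$ may be any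 $C^1$ functions on $V$. For $W\subset V$ open and $\phi$ a non-vanishing $C^r$ function on $W$, say that $\tilde g=\bar g/\phi^2$ solves (a) on $W$ if $\widetilde{\operatorname{Ric}}_i(X,Y)=T(X,Y)$ for all $X\in D_i$ and all tangent vectors $Y$ (so that also $\widetilde{\operatorname{Ric}}_i(D_1,D_2)=0$), $i=1,2$. Say that $(W,\phi)$ is of special form if, with $\varphi=\phi F$, the diagonal components of $T$ on $W$ are $$T_{ii}=\frac{p_2\varphi_{,ii}+\sum_{\alpha}\varphi_{,\alpha\alpha}}{\varphi}-\frac{p_2|\nabla\varphi|^2}{\varphi^2},\qquad T_{\alpha\alpha}=\frac{p_1\varphi_{,\alpha\alpha}+\sum_{i}\varphi_{,ii}}{\varphi}-\frac{p_1|\nabla\varphi|^2}{\varphi^2}$$ (Euclidean derivatives), and, up to interchanging $D_1$ and $D_2$ (with $p_1,p_2$) and renumbering the coordinates inside each of them, one of the following holds on $W$: (i) $f_{12}(x_1,x_2)$ is not identically zero, all other off-diagonal components of $T$ vanish, and $\varphi$ is a function of $(x_1,x_2)$ only with $\varphi_{,x_1x_2}=(f_{12}/p_2)\,\varphi$; (ii)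 there are an integer $p\in[3,p_1]$ and non-constant $C^r$ functions $U_j(x_j)$, $1\le j\le p$, and $a,b\in\mathbb R$ with $a^2+b^2>0$ such that all off-diagonal components of $T$ other than $T_{ij}$ with $i,j\le p$ vanish, and either $f_{ij}=p_2U_i'U_j'$ for all $i\ne j\le p$ and $\varphi=a\,e^{\sum_{j\le p}U_j}+b\,e^{-\sum_{j\le p}U_j}$, or $f_{ij}=-p_2U_i'U_j'$ for all $i\ne j\le p$ and $\varphi=a\cos(\sum_{j\le p}U_j)+b\sin(\sum_{j\le p}U_j)$. Then there are a non-empty open connected $W\subset V$ on which $T$ is not diagonal and a non-vanishing $C^r$ function $\phi$ on $W$ such that $\bar g/\phi^2$ solves (a) on $W$, if and only if there are such $W$ and $\phi$ with $(W,\phi)$ of special form. More precisely: if $\bar g/\phi^2$ solves (a) on an open set $W\subset V$, then every open $O\subset W$ on which $T$ is not diagonal contains a non-empty open connected $W'$, on which $T$ is not diagonal, such that $(W',\phi|_{W'})$ is of special form; and conversely, if $(W,\phi)$ is of special form, then $\bar g/\phi^2$ solves (a) on $W$. -/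

import Mathlib

open scoped ContDiff

noncomputable section

namespace PartialRicci

variable {n : ℕ}

/-- The coordinate derivative `∂f/∂x_A` on `ℝⁿ`. -/
def pd (A : Fin n) (f : (Fin n → ℝ) → ℝ) (x : Fin n → ℝ) : ℝ :=
  fderiv ℝ f x (Pi.single A 1)

/-- Christoffel symbols `Γ^C_{AB}` of the Levi-Civita connection of a metric `g` given by its
matrix of components in the coordinates. -/
def christoffel (g : (Fin n → ℝ) → Matrix (Fin n) (Fin n) ℝ) (C A B : Fin n)
    (x : Fin n → ℝ) : ℝ :=
  (1 / 2) * ∑ L, (g x)⁻¹ C L *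
    (pd A (fun y => g y B L) x + pd B (fun y => g y A L) x - pd L (fun y => g y A B) x)

/-- The `∂_L`-component of `R(∂_A, ∂_B) ∂_C`, where
`R(X, Y) = ∇_X ∇_Y - ∇_Y ∇_X - ∇_[X, Y]`. -/
def curv (g : (Fin n → ℝ) → Matrix (Fin n) (Fin n) ℝ) (L A B C : Fin n)
    (x : Fin n → ℝ) : ℝ :=
  pd A (christoffel g L B C) x - pd B (christoffel g L A C) x
    + ∑ K, (christoffel g L A K x * christoffel g K B C x
      - christoffel g L B K x * christoffel g K A C x)

/-- The number `g(R(∂_A, ∂_B) ∂_C, ∂_E)`. -/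
def curvLow (g : (Fin n → ℝ) → Matrix (Fin n) (Fin n) ℝ) (A B C E : Fin n)
    (x : Fin n → ℝ) : ℝ :=
  ∑ L, g x L E * curv g L A B C x

/-- The component `Ric(∂_A, ∂_B)` of the partial Ricci curvature obtained by tracing over the
coordinate distribution `span {∂_C : C ∈ S}`: the `g`-trace over that distribution of the
bilinear form `(X, Y) ↦ g(R(X, ∂_A) ∂_B, Y)`, i.e. `∑_C g(R(e_C, ∂_A) ∂_B, e_C)` for any
`g`-orthonormal frame `e_C` of it (see `sum_frame_eq_partialRic`).  For `S` the set of indices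
tangent to `D₂` this is `Ric₁`, for `S` the set of indices tangent to `D₁` it is `Ric₂`. -/
def partialRic (g : (Fin n → ℝ) → Matrix (Fin n) (Fin n) ℝ) (S : Finset (Fin n))
    (x : Fin n → ℝ) (A B : Fin n) : ℝ :=
  ∑ C : S, ∑ E : S, ((g x).submatrix (Subtype.val : S → Fin n) Subtype.val)⁻¹ C E *
    curvLow g C A B E x

/-- The definition of the partial Ricci curvature agrees with the sum over an arbitrary
`g`-orthonormal frame `e_c = ∑_C P C c • ∂_C` of `span {∂_C : C ∈ S}`. -/
theorem sum_frame_eq_partialRic (g : (Fin n → ℝ) → Matrix (Fin n) (Fin n) ℝ)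
    (S : Finset (Fin n)) (x : Fin n → ℝ) (A B : Fin n) (P : Matrix S S ℝ)
    (hP : P.transpose * (g x).submatrix (Subtype.val : S → Fin n) Subtype.val * P = 1) :
    ∑ c : S, ∑ C : S, ∑ E : S, P C c * P E c * curvLow g C A B E x
      = partialRic g S x A B := by
  have h1 : P * (P.transpose * (g x).submatrix (Subtype.val : S → Fin n) Subtype.val) = 1 :=
    mul_eq_one_comm.mp hP
  have h2 : ((g x).submatrix (Subtype.val : S → Fin n) Subtype.val)⁻¹ = P * P.transpose := by
    apply Matrix.inv_eq_left_inv
    rw [Matrix.mul_assoc, h1]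
  unfold partialRic
  rw [h2, Finset.sum_comm]
  refine Finset.sum_congr rfl fun C _ => ?_
  rw [Finset.sum_comm]
  refine Finset.sum_congr rfl fun E _ => ?_
  rw [Matrix.mul_apply, Finset.sum_mul]
  rfl

/-- The conformally flat metric with components `δ_{AB} / F²`. -/
def flatConformal (F : (Fin n → ℝ) → ℝ) (x : Fin n → ℝ) : Matrix (Fin n) (Fin n) ℝ :=
  Matrix.diagonal fun _ => 1 / F x ^ 2

/-- The conformal metric `(1 / φ²) g`. -/
def conformal (g : (Fin n → ℝ) → Matrix (Fin n) (Fin n) ℝ) (φ : (Fin n → ℝ) → ℝ)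
    (x : Fin n → ℝ) : Matrix (Fin n) (Fin n) ℝ :=
  (1 / φ x ^ 2) • g x

/-- The metric `g` solves the prescribed partial Ricci curvature problem for `T` on `W`, where
`D₁ = span {∂_A : A ∈ D}` and `D₂ = span {∂_A : A ∉ D}`:
`Ric₁(X, Y) = T(X, Y)` for `X ∈ D₁`, and `Ric₂(X, Y) = T(X, Y)` for `X ∈ D₂`
(with `Y` any tangent vector, so that the mixed components are prescribed as well). -/
def SolvesOn (D : Finset (Fin n)) (g T : (Fin n → ℝ) → Matrix (Fin n) (Fin n) ℝ)
    (W : Set (Fin n → ℝ)) : Prop :=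
  ∀ x ∈ W, (∀ A ∈ D, ∀ B, partialRic g Dᶜ x A B = T x A B) ∧
    (∀ A ∈ Dᶜ, ∀ B, partialRic g D x A B = T x A B)

/-- `T` is not diagonal on `W`: some off-diagonal component is not identically zero there. -/
def NonDiagonalOn (T : (Fin n → ℝ) → Matrix (Fin n) (Fin n) ℝ) (W : Set (Fin n → ℝ)) : Prop :=
  ∃ x ∈ W, ∃ A B, A ≠ B ∧ T x A B ≠ 0

/-- The diagonal components of `T` with index in `D` are the ones that `u` determines:
`T_{AA} = (#Dᶜ u_{AA} + Δ' u) / u - #Dᶜ |∇u|² / u²`, where `Δ' u = ∑_{B ∉ D} u_{BB}`. -/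
def DiagonalOn (D : Finset (Fin n)) (T : (Fin n → ℝ) → Matrix (Fin n) (Fin n) ℝ)
    (u : (Fin n → ℝ) → ℝ) (W : Set (Fin n → ℝ)) : Prop :=
  ∀ x ∈ W, ∀ A ∈ D, T x A A =
    ((Dᶜ.card : ℝ) * pd A (pd A u) x + ∑ B ∈ Dᶜ, pd B (pd B u) x) / u x
      - (Dᶜ.card : ℝ) * (∑ B, pd B u x ^ 2) / u x ^ 2

/-- First case: exactly one off-diagonal component `T_{ij}` (with `i ≠ j` in `D`) is nonzero,
and `u` depends on `x_i, x_j` only and satisfies `u_{x_i x_j} = (T_{ij} / #Dᶜ) u`. -/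
def CaseOne (D : Finset (Fin n)) (T : (Fin n → ℝ) → Matrix (Fin n) (Fin n) ℝ)
    (u : (Fin n → ℝ) → ℝ) (W : Set (Fin n → ℝ)) : Prop :=
  ∃ i ∈ D, ∃ j ∈ D, i ≠ j ∧
    (∃ x ∈ W, T x i j ≠ 0) ∧
    (∀ x ∈ W, ∀ A B, A ≠ B → s(A, B) ≠ s(i, j) → T x A B = 0) ∧
    (∃ v : ℝ → ℝ → ℝ, ∀ x ∈ W, u x = v (x i) (x j)) ∧
    (∀ x ∈ W, pd i (pd j u) x = T x i j / (Dᶜ.card : ℝ) * u x)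

/-- Second case: there are a set `S ⊆ D` of at least three indices and non-constant functions
`U_j(x_j)`, `j ∈ S`, with `T_{ij} = ± #Dᶜ U_i' U_j'` for distinct `i, j ∈ S`, all other
off-diagonal components being zero, and `u` has the form belonging to the sign. -/
def CaseTwo (r : ℕ∞) (D : Finset (Fin n)) (T : (Fin n → ℝ) → Matrix (Fin n) (Fin n) ℝ)
    (u : (Fin n → ℝ) → ℝ) (W : Set (Fin n → ℝ)) : Prop :=
  ∃ S ⊆ D, 3 ≤ S.card ∧
    (∀ x ∈ W, ∀ A B, A ≠ B → ¬(A ∈ S ∧ B ∈ S) → T x A B = 0) ∧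
    ∃ U : Fin n → ℝ → ℝ,
      (∀ j ∈ S, ContDiffOn ℝ r (U j) ((fun x : Fin n → ℝ => x j) '' W) ∧
        ∃ x ∈ W, ∃ y ∈ W, U j (x j) ≠ U j (y j)) ∧
      ∃ a b : ℝ, 0 < a ^ 2 + b ^ 2 ∧
        ((∀ x ∈ W,
            (∀ i ∈ S, ∀ j ∈ S, i ≠ j →
              T x i j = (Dᶜ.card : ℝ) * (deriv (U i) (x i) * deriv (U j) (x j))) ∧
            u x = a * Real.exp (∑ j ∈ S, U j (x j)) + b * Real.exp (-∑ j ∈ S, U j (x j))) ∨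
         (∀ x ∈ W,
            (∀ i ∈ S, ∀ j ∈ S, i ≠ j →
              T x i j = -((Dᶜ.card : ℝ) * (deriv (U i) (x i) * deriv (U j) (x j)))) ∧
            u x = a * Real.cos (∑ j ∈ S, U j (x j)) + b * Real.sin (∑ j ∈ S, U j (x j))))

/-- Up to a change of order of `D₁` and `D₂`, one of the two cases occurs on `W`, and the diagonal
components of `T` are those determined by `u`. -/
def OneOfCases (r : ℕ∞) (D : Finset (Fin n)) (T : (Fin n → ℝ) → Matrix (Fin n) (Fin n) ℝ)
    (u : (Fin n → ℝ) → ℝ) (W : Set (Fin n → ℝ)) : Prop :=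
  DiagonalOn D T u W ∧ DiagonalOn Dᶜ T u W ∧
    ((CaseOne D T u W ∨ CaseTwo r D T u W) ∨ (CaseOne Dᶜ T u W ∨ CaseTwo r Dᶜ T u W))

end PartialRicci

end

noncomputable section

namespace PartialRicci

open Filter Topology

variable {n : ℕ}

/-! Since `conformal (flatConformal F) φ` is `δ / u²` with `u = φ F`, everything is a statement
about `u`. By the explicit curvature of `δ / u²`, an off-diagonal partial Ricci component is a
positive constant times `u_{AB} / u`, and the diagonal ones are the expressions in `DiagonalOn`. So
solving the problem means the diagonal conditions plus the linear system `u_{AB} = q_{AB} u` for `A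
≠ B`, where `q_{AB}` is a constant multiple of `T_{AB}` (`solvesOn_flatConformal_iff`). The special
forms satisfy this system by direct differentiation.

Conversely, `q_{AB}` depends on `x_A, x_B` only, so equality of the mixed third derivatives gives
`q_{ij} u_k = q_{ik} u_j` (`HessianSystem.coeff_mul_pd`). Pass to a cube where some `T_{ij}` has no
zero and each `u_k` has no zero or vanishes identically, and let `S` be the set of `k` with `u_k`
zero-free. If `i, j` lie in `D`, an index `k ∈ S` outside `D` is impossible, because then `q_{ik} =
0` while `q_{ij} u_k ≠ 0`.

If `S = {i, j}`, this is the first case. Otherwise `u_i / u_j` depends on `x_i, x_j` only, and the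
relation `(u_i / u_l)(u_l / u_j) = u_i / u_j` with a third index forces `u_i = μ a_i(x_i)`
(`exists_separated`). Then `q_{ij} = ν a_i a_j` with the same `ν` for all pairs, and three indices
make `ν` a constant `κ` (`exists_coeff_eq_mul`). After rescaling by `√|κ|`, `u` satisfies `u'' = ±
u` as a function of `∑ U_j`, whence the exponential or trigonometric form (`exists_form`). -/

/-! ### Calculus of coordinate derivatives -/

theorem pd_congr {A : Fin n} {f g : (Fin n → ℝ) → ℝ} {x : Fin n → ℝ} (h : f =ᶠ[𝓝 x] g) :
    pd A f x = pd A g x := by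
  unfold pd
  rw [h.fderiv_eq]

theorem pd_congr_of_eqOn {A : Fin n} {f g : (Fin n → ℝ) → ℝ} {W : Set (Fin n → ℝ)}
    (hW : IsOpen W) (h : ∀ y ∈ W, f y = g y) {x : Fin n → ℝ} (hx : x ∈ W) :
    pd A f x = pd A g x :=
  pd_congr (by filter_upwards [hW.mem_nhds hx] with y hy using h y hy)

@[simp] theorem pd_const (A : Fin n) (c : ℝ) (x : Fin n → ℝ) : pd A (fun _ => c) x = 0 := by
  simp [pd]

theorem pd_eq_of_hasFDerivAt {A : Fin n} {f : (Fin n → ℝ) → ℝ} {f' : (Fin n → ℝ) →L[ℝ] ℝ}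
    {x : Fin n → ℝ} (h : HasFDerivAt f f' x) : pd A f x = f' (Pi.single A 1) := by
  rw [pd, h.fderiv]

theorem pd_add {A : Fin n} {f g : (Fin n → ℝ) → ℝ} {x : Fin n → ℝ}
    (hf : DifferentiableAt ℝ f x) (hg : DifferentiableAt ℝ g x) :
    pd A (fun y => f y + g y) x = pd A f x + pd A g x := by
  rw [pd_eq_of_hasFDerivAt (hf.hasFDerivAt.fun_add hg.hasFDerivAt)]
  simp [pd]

theorem pd_sub {A : Fin n} {f g : (Fin n → ℝ) → ℝ} {x : Fin n → ℝ}
    (hf : DifferentiableAt ℝ f x) (hg : DifferentiableAt ℝ g x) :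
    pd A (fun y => f y - g y) x = pd A f x - pd A g x := by
  rw [pd_eq_of_hasFDerivAt (hf.hasFDerivAt.fun_sub hg.hasFDerivAt)]
  simp [pd]

theorem pd_mul {A : Fin n} {f g : (Fin n → ℝ) → ℝ} {x : Fin n → ℝ}
    (hf : DifferentiableAt ℝ f x) (hg : DifferentiableAt ℝ g x) :
    pd A (fun y => f y * g y) x = pd A f x * g x + f x * pd A g x := by
  rw [pd_eq_of_hasFDerivAt (hf.hasFDerivAt.fun_mul hg.hasFDerivAt)]
  simp [pd]
  ring

theorem pd_comp {A : Fin n} {f : (Fin n → ℝ) → ℝ} {h : ℝ → ℝ} {h' : ℝ} {x : Fin n → ℝ}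
    (hh : HasDerivAt h h' (f x)) (hf : DifferentiableAt ℝ f x) :
    pd A (fun y => h (f y)) x = h' * pd A f x := by
  have h1 : HasFDerivAt (fun y => h (f y)) _ x := hh.comp_hasFDerivAt x hf.hasFDerivAt
  rw [pd_eq_of_hasFDerivAt h1]
  simp [pd]

theorem pd_const_mul {A : Fin n} {f : (Fin n → ℝ) → ℝ} {x : Fin n → ℝ} (c : ℝ)
    (hf : DifferentiableAt ℝ f x) : pd A (fun y => c * f y) x = c * pd A f x := by
  rw [pd_mul (differentiableAt_const c) hf]
  simp

theorem pd_div {A : Fin n} {f g : (Fin n → ℝ) → ℝ} {x : Fin n → ℝ}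
    (hf : DifferentiableAt ℝ f x) (hg : DifferentiableAt ℝ g x) (h0 : g x ≠ 0) :
    pd A (fun y => f y / g y) x = (pd A f x * g x - f x * pd A g x) / g x ^ 2 := by
  simp only [div_eq_mul_inv (f _)]
  rw [pd_mul hf (hg.fun_inv h0), pd_comp (hasDerivAt_inv h0) hg]
  field_simp
  ring

theorem pd_sum {ι : Type*} {A : Fin n} (s : Finset ι) {f : ι → (Fin n → ℝ) → ℝ} {x : Fin n → ℝ}
    (hf : ∀ i ∈ s, DifferentiableAt ℝ (f i) x) :
    pd A (fun y => ∑ i ∈ s, f i y) x = ∑ i ∈ s, pd A (f i) x := by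
  rw [pd_eq_of_hasFDerivAt (HasFDerivAt.fun_sum fun i hi => (hf i hi).hasFDerivAt)]
  simp [pd]

theorem differentiableAt_comp_apply {h : ℝ → ℝ} {h' : ℝ} {k : Fin n} {x : Fin n → ℝ}
    (hh : HasDerivAt h h' (x k)) : DifferentiableAt ℝ (fun y : Fin n → ℝ => h (y k)) x :=
  DifferentiableAt.comp (g := h) (f := fun y : Fin n → ℝ => y k) x hh.differentiableAt
    (differentiableAt_apply k x)

theorem pd_comp_apply {A k : Fin n} {h : ℝ → ℝ} {h' : ℝ} {x : Fin n → ℝ}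
    (hh : HasDerivAt h h' (x k)) :
    pd A (fun y => h (y k)) x = if A = k then h' else 0 := by
  have h0 : pd A (fun y : Fin n → ℝ => y k) x = if A = k then 1 else 0 := by
    rw [pd_eq_of_hasFDerivAt (hasFDerivAt_apply k x)]
    simp [Pi.single_apply, eq_comm]
  rw [pd_comp (f := fun y : Fin n → ℝ => y k) hh (differentiableAt_apply k x), h0]
  simp

/-- The partial derivative in a direction on which the function does not depend vanishes. -/
theorem pd_eq_zero_of_eventually {k : Fin n} {f : (Fin n → ℝ) → ℝ} {x : Fin n → ℝ}
    (h : ∀ᶠ y in 𝓝 x, (∀ j, j ≠ k → y j = x j) → f y = f x) : pd k f x = 0 := by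
  by_cases hf : DifferentiableAt ℝ f x
  · have h1 : HasLineDerivAt ℝ f (pd k f x) x (Pi.single k 1) := hf.hasFDerivAt.hasLineDerivAt _
    have h2 : (fun t : ℝ => f (x + t • Pi.single k 1)) =ᶠ[𝓝 0] fun _ => f x := by
      have hc : Tendsto (fun t : ℝ => x + t • (Pi.single k 1 : Fin n → ℝ)) (𝓝 0) (𝓝 x) := by
        have : Continuous (fun t : ℝ => x + t • (Pi.single k 1 : Fin n → ℝ)) := by fun_prop
        simpa using this.tendsto 0
      filter_upwards [hc.eventually h] with t ht
      exact ht fun j hj => by simp [hj]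
    have h3 : HasDerivAt (fun _ : ℝ => f x) (pd k f x) 0 :=
      HasDerivAt.congr_of_eventuallyEq h1 h2.symm
    exact h3.unique (hasDerivAt_const _ _)
  -- Without differentiability `fderiv` is zero by convention, so no regularity of `f` is needed.
  · simp [pd, fderiv_zero_of_not_differentiableAt hf]

theorem fderiv_apply_eq_sum_pd (f : (Fin n → ℝ) → ℝ) (x v : Fin n → ℝ) :
    fderiv ℝ f x v = ∑ k, v k * pd k f x := by
  conv_lhs => rw [pi_eq_sum_univ' v]
  simp [pd]

/-- On a convex set, a function depends only on those coordinates in whose direction its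
derivative is not zero. -/
theorem eq_of_pd_eq_zero {f : (Fin n → ℝ) → ℝ} {B : Set (Fin n → ℝ)} (hB : Convex ℝ B)
    (hf : ∀ x ∈ B, DifferentiableAt ℝ f x) {x y : Fin n → ℝ} (hx : x ∈ B) (hy : y ∈ B)
    (h : ∀ k, x k = y k ∨ ∀ z ∈ B, pd k f z = 0) : f x = f y := by
  let γ : ℝ → Fin n → ℝ := fun t => x + t • (y - x)
  have hγ : ∀ t ∈ Set.Icc (0 : ℝ) 1, γ t ∈ B := fun t ht => by
    have := hB.add_smul_sub_mem hx hy ht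
    exact this
  have hd : ∀ t ∈ Set.Icc (0 : ℝ) 1, HasDerivAt (fun t => f (γ t)) 0 t := fun t ht => by
    have h1 : HasDerivAt γ (y - x) t := by
      have := ((hasDerivAt_id t).smul_const (y - x)).const_add x
      rwa [one_smul] at this
    have h2 := (hf _ (hγ t ht)).hasFDerivAt.comp_hasDerivAt t h1
    rw [fderiv_apply_eq_sum_pd, Finset.sum_eq_zero] at h2
    · exact h2
    · intro k _
      rcases h k with h | h
      · simp [h]
      · simp [h _ (hγ t ht)]
  have h3 := constant_of_has_deriv_right_zero (f := fun t => f (γ t)) (a := 0) (b := 1)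
    (fun t ht => (hd t ht).continuousAt.continuousWithinAt)
    (fun t ht => (hd t ⟨ht.1, ht.2.le⟩).hasDerivWithinAt) 1 (by simp)
  simpa [γ] using h3.symm

theorem contDiffOn_pd {k m : WithTop ℕ∞} {f : (Fin n → ℝ) → ℝ} {W : Set (Fin n → ℝ)}
    (hW : IsOpen W) (hf : ContDiffOn ℝ m f W) (hk : k + 1 ≤ m) (A : Fin n) :
    ContDiffOn ℝ k (pd A f) W :=
  (hf.fderiv_of_isOpen hW hk).clm_apply contDiffOn_const

theorem pd_comm {f : (Fin n → ℝ) → ℝ} {W : Set (Fin n → ℝ)} (hW : IsOpen W)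
    (hf : ContDiffOn ℝ 2 f W) {x : Fin n → ℝ} (hx : x ∈ W) (A B : Fin n) :
    pd A (pd B f) x = pd B (pd A f) x := by
  have h1 : DifferentiableAt ℝ (fderiv ℝ f) x :=
    ((hf.fderiv_of_isOpen (m := 1) hW (by norm_num)).differentiableOn (by norm_num)).differentiableAt
      (hW.mem_nhds hx)
  have h2 : ∀ A B, pd A (pd B f) x = fderiv ℝ (fderiv ℝ f) x (Pi.single A 1) (Pi.single B 1) := by
    intro A B
    have h3 := h1.hasFDerivAt.clm_apply (hasFDerivAt_const (Pi.single B 1 : Fin n → ℝ) x)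
    have h4 := pd_eq_of_hasFDerivAt (A := A) h3
    simp only [ContinuousLinearMap.comp_zero, zero_add, ContinuousLinearMap.flip_apply] at h4
    exact h4
  rw [h2, h2]
  exact ((hf.contDiffAt (hW.mem_nhds hx)).isSymmSndFDerivAt (by simp)) _ _

/-- Mixed derivatives in two directions commute as soon as the two first derivatives in these
directions are differentiable. -/
theorem pd_comm_of_differentiableAt {G P Q : (Fin n → ℝ) → ℝ} {B : Set (Fin n → ℝ)}
    (hB : IsOpen B) (hG : ∀ x ∈ B, DifferentiableAt ℝ G x) {a b : Fin n}
    (hP : ∀ x ∈ B, pd a G x = P x) (hQ : ∀ x ∈ B, pd b G x = Q x) {x : Fin n → ℝ} (hx : x ∈ B)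
    (hPd : DifferentiableAt ℝ P x) (hQd : DifferentiableAt ℝ Q x) :
    pd b P x = pd a Q x := by
  let ea : Fin n → ℝ := Pi.single a 1
  let eb : Fin n → ℝ := Pi.single b 1
  -- Restricted to the coordinate plane through `x`, the function has near `0` a derivative built
  -- from `P` and `Q` alone. This derivative is differentiable at `0`, which suffices for symmetry
  -- of the second derivative.
  let L : ℝ × ℝ →L[ℝ] (Fin n → ℝ) :=
    (ContinuousLinearMap.fst ℝ ℝ ℝ).smulRight ea + (ContinuousLinearMap.snd ℝ ℝ ℝ).smulRight eb
  have hL : ∀ p : ℝ × ℝ, HasFDerivAt (fun p => x + L p) L p := fun p =>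
    L.hasFDerivAt.const_add x
  have hx0 : x + L 0 = x := by simp
  have hmem : ∀ᶠ p in 𝓝 (0 : ℝ × ℝ), x + L p ∈ B := by
    have : Tendsto (fun p => x + L p) (𝓝 0) (𝓝 x) := by
      have := (hL 0).continuousAt.tendsto
      rwa [hx0] at this
    exact this.eventually (hB.mem_nhds hx)
  have h1 : ∀ᶠ p in 𝓝 (0 : ℝ × ℝ), HasFDerivAt (fun p => G (x + L p))
      (P (x + L p) • ContinuousLinearMap.fst ℝ ℝ ℝ + Q (x + L p) • ContinuousLinearMap.snd ℝ ℝ ℝ)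
      p := by
    filter_upwards [hmem] with p hp
    refine ((hG _ hp).hasFDerivAt.comp p (hL p)).congr_fderiv ?_
    have e1 := hP _ hp
    have e2 := hQ _ hp
    unfold pd at e1 e2
    refine ContinuousLinearMap.ext fun v => ?_
    have h3 : L v = v.1 • ea + v.2 • eb := rfl
    rw [ContinuousLinearMap.comp_apply, h3, map_add, map_smul, map_smul, e1, e2]
    simp [mul_comm]
  have hP' : HasFDerivAt (fun p => P (x + L p)) ((fderiv ℝ P x).comp L) 0 := by
    refine HasFDerivAt.comp (g := P) 0 ?_ (hL 0)
    rw [hx0]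
    exact hPd.hasFDerivAt
  have hQ' : HasFDerivAt (fun p => Q (x + L p)) ((fderiv ℝ Q x).comp L) 0 := by
    refine HasFDerivAt.comp (g := Q) 0 ?_ (hL 0)
    rw [hx0]
    exact hQd.hasFDerivAt
  have h2 := (hP'.smul_const (ContinuousLinearMap.fst ℝ ℝ ℝ)).fun_add
    (hQ'.smul_const (ContinuousLinearMap.snd ℝ ℝ ℝ))
  have h3 := second_derivative_symmetric_of_eventually h1 h2 (0, 1) (1, 0)
  simpa [L, ea, eb, pd] using h3

/-! ### Curvature of the metric `δ / u²` -/

theorem conformal_flatConformal (F φ : (Fin n → ℝ) → ℝ) :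
    conformal (flatConformal F) φ = flatConformal fun x => φ x * F x := by
  funext x
  ext A B
  simp only [conformal, flatConformal, Matrix.smul_apply, Matrix.diagonal_apply, smul_eq_mul]
  split_ifs <;> simp [mul_pow, mul_comm]

theorem flatConformal_inv {u : (Fin n → ℝ) → ℝ} {x : Fin n → ℝ} (hu : u x ≠ 0) :
    (flatConformal u x)⁻¹ = Matrix.diagonal fun _ => u x ^ 2 := by
  apply Matrix.inv_eq_left_inv
  simp [flatConformal, hu]

theorem flatConformal_submatrix_inv {u : (Fin n → ℝ) → ℝ} {x : Fin n → ℝ} (hu : u x ≠ 0)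
    (S : Finset (Fin n)) :
    ((flatConformal u x).submatrix (Subtype.val : S → Fin n) Subtype.val)⁻¹
      = Matrix.diagonal fun _ => u x ^ 2 := by
  apply Matrix.inv_eq_left_inv
  rw [flatConformal, Matrix.submatrix_diagonal _ _ Subtype.val_injective]
  ext C E
  by_cases h : C = E <;> simp [Matrix.one_apply, h, hu]

theorem pd_flatConformal {u : (Fin n → ℝ) → ℝ} {x : Fin n → ℝ} (hu : u x ≠ 0)
    (hd : DifferentiableAt ℝ u x) (A B C : Fin n) :
    pd A (fun y => flatConformal u y B C) x = if B = C then -2 * pd A u x / u x ^ 3 else 0 := by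
  by_cases h : B = C
  · subst h
    have h1 : HasDerivAt (fun t : ℝ => 1 / t ^ 2) (-2 / u x ^ 3) (u x) := by
      have := (hasDerivAt_pow 2 (u x)).fun_inv (pow_ne_zero 2 hu)
      simp only [one_div]
      refine this.congr_deriv ?_
      field_simp
      norm_num [mul_comm]
    have h2 := pd_comp (A := A) h1 hd
    simp only [flatConformal, Matrix.diagonal_apply_eq, if_true]
    rw [h2]
    ring
  · simp [flatConformal, h]

theorem christoffel_flatConformal {u : (Fin n → ℝ) → ℝ} {x : Fin n → ℝ} (hu : u x ≠ 0)
    (hd : DifferentiableAt ℝ u x) (C A B : Fin n) :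
    christoffel (flatConformal u) C A B x =
      (if B = C then 1 else 0) * (-pd A u x / u x) + (if A = C then 1 else 0) * (-pd B u x / u x)
        - (if A = B then 1 else 0) * (-pd C u x / u x) := by
  unfold christoffel
  simp only [flatConformal_inv hu, pd_flatConformal hu hd, Matrix.diagonal_apply, ite_mul, zero_mul,
    Finset.sum_ite_eq, Finset.mem_univ, if_true]
  split_ifs <;> field_simp <;> ring

/-- The Christoffel symbols are linear in `l_B = -u_B / u`, so the curvature needs only the rule
`∂_A l_B = -u_{AB} / u + l_A l_B`. -/
theorem pd_logDeriv {u : (Fin n → ℝ) → ℝ} {W : Set (Fin n → ℝ)} (hW : IsOpen W)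
    (hu : ContDiffOn ℝ 2 u W) (h0 : ∀ x ∈ W, u x ≠ 0) {x : Fin n → ℝ} (hx : x ∈ W)
    (A B : Fin n) :
    DifferentiableAt ℝ (fun y => -pd B u y / u y) x ∧
    pd A (fun y => -pd B u y / u y) x =
      -pd A (pd B u) x / u x + (-pd A u x / u x) * (-pd B u x / u x) := by
  have hd : DifferentiableAt ℝ u x :=
    (hu.differentiableOn (by norm_num)).differentiableAt (hW.mem_nhds hx)
  have hd' : DifferentiableAt ℝ (pd B u) x :=
    ((contDiffOn_pd hW hu (k := 1) (by norm_num) B).differentiableOn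
      (by norm_num)).differentiableAt (hW.mem_nhds hx)
  refine ⟨by simpa only [div_eq_mul_inv] using hd'.fun_neg.fun_mul (hd.fun_inv (h0 x hx)), ?_⟩
  rw [pd_div hd'.fun_neg hd (h0 x hx)]
  have : pd A (fun y => -pd B u y) x = -pd A (pd B u) x := by
    have := pd_const_mul (A := A) (-1) hd'
    simpa using this
  rw [this]
  have := h0 x hx
  field_simp
  ring

theorem pd_christoffel {u : (Fin n → ℝ) → ℝ} {W : Set (Fin n → ℝ)} (hW : IsOpen W)
    (hu : ContDiffOn ℝ 2 u W) (h0 : ∀ x ∈ W, u x ≠ 0) {x : Fin n → ℝ} (hx : x ∈ W)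
    (E C A B : Fin n) :
    pd E (christoffel (flatConformal u) C A B) x =
      (if B = C then 1 else 0) * (pd E (fun y => -pd A u y / u y) x)
      + (if A = C then 1 else 0) * (pd E (fun y => -pd B u y / u y) x)
        - (if A = B then 1 else 0) * (pd E (fun y => -pd C u y / u y) x) := by
  have h1 : ∀ y ∈ W, christoffel (flatConformal u) C A B y = _ := fun y hy =>
    christoffel_flatConformal (h0 y hy)
      ((hu.differentiableOn (by norm_num)).differentiableAt (hW.mem_nhds hy)) C A B
  rw [pd_congr_of_eqOn hW h1 hx]
  have hd : ∀ B, DifferentiableAt ℝ (fun y => -pd B u y / u y) x := fun B =>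
    (pd_logDeriv hW hu h0 hx B B).1
  have hc : ∀ (c : ℝ) B, DifferentiableAt ℝ (fun y => c * (-pd B u y / u y)) x := fun c B =>
    (hd B).const_mul c
  rw [pd_sub ((hc _ A).fun_add (hc _ B)) (hc _ C), pd_add (hc _ A) (hc _ B),
    pd_const_mul _ (hd A), pd_const_mul _ (hd B), pd_const_mul _ (hd C)]

/-- As the metric is diagonal, the traces involve only these components, where the upper index
equals the first index of the curvature. -/
theorem curv_flatConformal {u : (Fin n → ℝ) → ℝ} {W : Set (Fin n → ℝ)} (hW : IsOpen W)
    (hu : ContDiffOn ℝ 2 u W) (h0 : ∀ x ∈ W, u x ≠ 0) {x : Fin n → ℝ} (hx : x ∈ W)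
    {A C : Fin n} (hAC : A ≠ C) (B : Fin n) :
    curv (flatConformal u) C C A B x =
      (if A = B then 1 else 0) * (pd C (pd C u) x / u x - (∑ K, pd K u x ^ 2) / u x ^ 2)
        + pd A (pd B u) x / u x - (if B = C then 1 else 0) * (pd A (pd C u) x / u x) := by
  have hd : DifferentiableAt ℝ u x :=
    (hu.differentiableOn (by norm_num)).differentiableAt (hW.mem_nhds hx)
  unfold curv
  have e : (∑ K, pd K u x ^ 2) / u x ^ 2 = ∑ K, (-pd K u x / u x) * (-pd K u x / u x) := by
    rw [Finset.sum_div]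
    exact Finset.sum_congr rfl fun K _ => by ring
  rw [e]
  simp only [pd_christoffel hW hu h0 hx, christoffel_flatConformal (h0 x hx) hd,
    (pd_logDeriv hW hu h0 hx _ _).2, if_true, one_mul]
  generalize hl : (fun K => -pd K u x / u x) = l
  have hl' : ∀ K, -pd K u x / u x = l K := fun K => congrFun hl K
  simp only [hl']
  have hAC' : C ≠ A := hAC.symm
  -- The part quadratic in the Christoffel symbols: Kronecker deltas collapse all sums except that
  -- of `l_K²`.
  have key : ∑ K, (((if K = C then (1:ℝ) else 0) * l C + l K
      - (if C = K then 1 else 0) * l C) *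
      ((if B = K then 1 else 0) * l A + (if A = K then 1 else 0) * l B
        - (if A = B then 1 else 0) * l K)
      - ((if K = C then 1 else 0) * l A + (if A = C then 1 else 0) * l K
        - (if A = K then 1 else 0) * l C) *
      ((if B = K then 1 else 0) * l C + (if C = K then 1 else 0) * l B
        - (if C = B then 1 else 0) * l K))
      = l A * l B - (if A = B then 1 else 0) * (∑ K, l K * l K)
        + (if A = B then 1 else 0) * (l C * l C) - (if B = C then 1 else 0) * (l C * l A) := by
    have : ∀ K, (((if K = C then (1:ℝ) else 0) * l C + l K
      - (if C = K then 1 else 0) * l C) *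
      ((if B = K then 1 else 0) * l A + (if A = K then 1 else 0) * l B
        - (if A = B then 1 else 0) * l K)
      - ((if K = C then 1 else 0) * l A + (if A = C then 1 else 0) * l K
        - (if A = K then 1 else 0) * l C) *
      ((if B = K then 1 else 0) * l C + (if C = K then 1 else 0) * l B
        - (if C = B then 1 else 0) * l K))
      = (if B = K then l K * l A else 0) + (if A = K then l K * l B else 0)
        - (if A = B then 1 else 0) * (l K * l K)
        - (if C = K then l A * ((if B = K then 1 else 0) * l C + (if C = K then 1 else 0) * l B
        - (if C = B then 1 else 0) * l K) else 0)
        + (if A = K then l C * ((if B = K then 1 else 0) * l C + (if C = K then 1 else 0) * l B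
        - (if C = B then 1 else 0) * l K) else 0) := by
      intro K
      simp only [if_neg hAC, eq_comm (a := K) (b := C)]
      split_ifs <;> ring
    rw [Finset.sum_congr rfl fun K _ => this K]
    simp only [Finset.sum_add_distrib, Finset.sum_sub_distrib, Finset.sum_ite_eq, Finset.mem_univ,
      if_true, ← Finset.mul_sum, if_neg hAC', eq_comm (a := C) (b := B),
      eq_comm (a := B) (b := A)]
    split_ifs <;> ring
  rw [key]
  -- Needed when `B = C`, where the derivatives of `u` in the directions `A` and `C` occur in both
  -- orders.
  have hc := pd_comm hW hu hx C A
  simp only [if_neg hAC, eq_comm (a := C) (b := B)]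
  split_ifs <;> first | ring1 | (rw [hc]; ring1)

theorem partialRic_flatConformal {u : (Fin n → ℝ) → ℝ} {W : Set (Fin n → ℝ)} (hW : IsOpen W)
    (hu : ContDiffOn ℝ 2 u W) (h0 : ∀ x ∈ W, u x ≠ 0) {x : Fin n → ℝ} (hx : x ∈ W)
    {S : Finset (Fin n)} {A : Fin n} (hA : A ∉ S) (B : Fin n) :
    partialRic (flatConformal u) S x A B = ∑ C ∈ S,
      ((if A = B then 1 else 0) * (pd C (pd C u) x / u x - (∑ K, pd K u x ^ 2) / u x ^ 2)
        + pd A (pd B u) x / u x - (if B = C then 1 else 0) * (pd A (pd C u) x / u x)) := by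
  unfold partialRic
  rw [flatConformal_submatrix_inv (h0 x hx), ← Finset.sum_coe_sort S]
  refine Finset.sum_congr rfl fun C _ => ?_
  have hAC : A ≠ C := fun h => hA (h ▸ C.2)
  rw [← curv_flatConformal hW hu h0 hx hAC B]
  simp only [Matrix.diagonal_apply, ite_mul, zero_mul, Finset.sum_ite_eq, Finset.mem_univ, if_true,
    curvLow, flatConformal]
  rw [Finset.sum_eq_single (C : Fin n) (by intro L _ hL; simp [hL]) (by simp), if_pos rfl]
  have := h0 x hx
  field_simp

theorem partialRic_flatConformal_self {u : (Fin n → ℝ) → ℝ} {W : Set (Fin n → ℝ)} (hW : IsOpen W)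
    (hu : ContDiffOn ℝ 2 u W) (h0 : ∀ x ∈ W, u x ≠ 0) {x : Fin n → ℝ} (hx : x ∈ W)
    {S : Finset (Fin n)} {A : Fin n} (hA : A ∉ S) :
    partialRic (flatConformal u) S x A A =
      ((S.card : ℝ) * pd A (pd A u) x + ∑ B ∈ S, pd B (pd B u) x) / u x
      - (S.card : ℝ) * (∑ B, pd B u x ^ 2) / u x ^ 2 := by
  rw [partialRic_flatConformal hW hu h0 hx hA]
  have : ∀ C ∈ S, (if A = A then (1:ℝ) else 0) * (pd C (pd C u) x / u x
      - (∑ K, pd K u x ^ 2) / u x ^ 2)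
        + pd A (pd A u) x / u x - (if A = C then 1 else 0) * (pd A (pd C u) x / u x)
      = pd C (pd C u) x / u x + (pd A (pd A u) x / u x - (∑ K, pd K u x ^ 2) / u x ^ 2) := by
    intro C hC
    have : A ≠ C := fun h => hA (h ▸ hC)
    simp [this]
    ring
  rw [Finset.sum_congr rfl this, Finset.sum_add_distrib, Finset.sum_const, ← Finset.sum_div]
  simp only [nsmul_eq_mul]
  ring

/-- Each traced index `C` contributes `u_{AB} / u`, except `C = B`, whose contribution vanishes by
antisymmetry of the curvature. -/
theorem partialRic_flatConformal_of_ne {u : (Fin n → ℝ) → ℝ} {W : Set (Fin n → ℝ)}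
    (hW : IsOpen W) (hu : ContDiffOn ℝ 2 u W) (h0 : ∀ x ∈ W, u x ≠ 0) {x : Fin n → ℝ} (hx : x ∈ W)
    {S : Finset (Fin n)} {A B : Fin n} (hA : A ∉ S) (hAB : A ≠ B) :
    partialRic (flatConformal u) S x A B =
      ((S.card : ℝ) - if B ∈ S then 1 else 0) * pd A (pd B u) x / u x := by
  rw [partialRic_flatConformal hW hu h0 hx hA]
  simp only [if_neg hAB, zero_mul, zero_add, ite_mul, one_mul, Finset.sum_sub_distrib,
    Finset.sum_ite_eq, Finset.sum_const, nsmul_eq_mul]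
  split_ifs <;> ring

/-! ### Reduction to a linear system for `u` -/

/-- The number of terms in the trace over the distribution complementary to that of `A` which
contribute to the off-diagonal component with indices `A`, `B`. -/
def traceCoeff (D : Finset (Fin n)) (A B : Fin n) : ℝ :=
  (if A ∈ D then (Dᶜ.card : ℝ) else (D.card : ℝ)) - if (A ∈ D ↔ B ∈ D) then 0 else 1

theorem traceCoeff_of_mem {D : Finset (Fin n)} {A B : Fin n} (hA : A ∈ D) (hB : B ∈ D) :
    traceCoeff D A B = Dᶜ.card := by
  simp [traceCoeff, hA, hB]

theorem traceCoeff_pos {D : Finset (Fin n)} (hD₁ : 3 ≤ D.card) (hD₂ : 3 ≤ Dᶜ.card) (A B : Fin n) :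
    0 < traceCoeff D A B := by
  have h1 : (3 : ℝ) ≤ D.card := by exact_mod_cast hD₁
  have h2 : (3 : ℝ) ≤ Dᶜ.card := by exact_mod_cast hD₂
  unfold traceCoeff
  split_ifs <;> linarith

theorem solvesOn_flatConformal_iff {u : (Fin n → ℝ) → ℝ} {W : Set (Fin n → ℝ)} (hW : IsOpen W)
    (hu : ContDiffOn ℝ 2 u W) (h0 : ∀ x ∈ W, u x ≠ 0) (D : Finset (Fin n))
    (T : (Fin n → ℝ) → Matrix (Fin n) (Fin n) ℝ) :
    SolvesOn D (flatConformal u) T W ↔ DiagonalOn D T u W ∧ DiagonalOn Dᶜ T u W ∧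
      ∀ x ∈ W, ∀ A B, A ≠ B → T x A B * u x = traceCoeff D A B * pd A (pd B u) x := by
  have hoff : ∀ x ∈ W, ∀ A B, A ≠ B →
      ((A ∈ D → partialRic (flatConformal u) Dᶜ x A B = T x A B) ∧
       (A ∈ Dᶜ → partialRic (flatConformal u) D x A B = T x A B) ↔
        T x A B * u x = traceCoeff D A B * pd A (pd B u) x) := by
    intro x hx A B hAB
    by_cases hA : A ∈ D
    · have hA' : A ∉ Dᶜ := by simpa using hA
      rw [partialRic_flatConformal_of_ne hW hu h0 hx hA' hAB, div_eq_iff (h0 x hx)]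
      by_cases hB : B ∈ D <;> simp [traceCoeff, hA, hB, eq_comm]
    · have hA' : A ∈ Dᶜ := by simpa using hA
      rw [partialRic_flatConformal_of_ne hW hu h0 hx hA hAB, div_eq_iff (h0 x hx)]
      by_cases hB : B ∈ D <;> simp [traceCoeff, hA, hB, eq_comm]
  constructor
  · intro h
    refine ⟨fun x hx A hA => ?_, fun x hx A hA => ?_, fun x hx A B hAB => ?_⟩
    · rw [← (h x hx).1 A hA A]
      exact partialRic_flatConformal_self hW hu h0 hx (by simpa using hA)
    · rw [← (h x hx).2 A hA A]
      simpa using partialRic_flatConformal_self hW hu h0 hx (S := D) (by simpa using hA)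
    · exact (hoff x hx A B hAB).1 ⟨fun hA => (h x hx).1 A hA B, fun hA => (h x hx).2 A hA B⟩
  · rintro ⟨h1, h2, h3⟩ x hx
    refine ⟨fun A hA B => ?_, fun A hA B => ?_⟩
    · by_cases hAB : A = B
      · subst hAB
        rw [h1 x hx A hA]
        exact partialRic_flatConformal_self hW hu h0 hx (by simpa using hA)
      · exact ((hoff x hx A B hAB).2 (h3 x hx A B hAB)).1 hA
    · by_cases hAB : A = B
      · subst hAB
        rw [h2 x hx A hA]
        simpa using partialRic_flatConformal_self hW hu h0 hx (S := D) (by simpa using hA)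
      · exact ((hoff x hx A B hAB).2 (h3 x hx A B hAB)).2 hA

theorem solvesOn_compl {D : Finset (Fin n)} {g T : (Fin n → ℝ) → Matrix (Fin n) (Fin n) ℝ}
    {W : Set (Fin n → ℝ)} : SolvesOn Dᶜ g T W ↔ SolvesOn D g T W := by
  simp only [SolvesOn, compl_compl]
  exact forall₂_congr fun _ _ => and_comm

/-! ### The special forms are solutions -/

theorem pd_pd_eq_zero {u : (Fin n → ℝ) → ℝ} {W : Set (Fin n → ℝ)} (hW : IsOpen W)
    (hu : ContDiffOn ℝ 2 u W) {k : Fin n} (hk : ∀ y ∈ W, pd k u y = 0) {x : Fin n → ℝ}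
    (hx : x ∈ W) (A : Fin n) : pd A (pd k u) x = 0 ∧ pd k (pd A u) x = 0 := by
  have h : pd A (pd k u) x = 0 := by
    rw [pd_congr_of_eqOn hW hk hx, pd_const]
  exact ⟨h, by rw [pd_comm hW hu hx, h]⟩

/-- A pair of distinct indices other than `{i, j}` contains a coordinate on which `u` does not
depend, so both sides vanish. The pair `(j, i)` follows from `(i, j)` by symmetry of `T` and of the
second derivatives. -/
theorem pd_pd_of_caseOne {D : Finset (Fin n)} {T : (Fin n → ℝ) → Matrix (Fin n) (Fin n) ℝ}
    {u : (Fin n → ℝ) → ℝ} {W : Set (Fin n → ℝ)} (hW : IsOpen W) (hu : ContDiffOn ℝ 2 u W)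
    (hT : ∀ x ∈ W, (T x).IsSymm) (hp : (Dᶜ.card : ℝ) ≠ 0) (h : CaseOne D T u W) :
    ∀ x ∈ W, ∀ A B, A ≠ B → T x A B * u x = traceCoeff D A B * pd A (pd B u) x := by
  obtain ⟨i, hi, j, hj, hij, -, hzero, ⟨v, hv⟩, hpd⟩ := h
  intro x hx A B hAB
  have hk : ∀ k, k ≠ i → k ≠ j → ∀ y ∈ W, pd k u y = 0 := by
    intro k hki hkj y hy
    apply pd_eq_zero_of_eventually
    filter_upwards [hW.mem_nhds hy] with z hz hzy
    rw [hv z hz, hv y hy, hzy i hki.symm, hzy j hkj.symm]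
  by_cases hs : s(A, B) = s(i, j)
  · rcases Sym2.eq_iff.1 hs with ⟨rfl, rfl⟩ | ⟨rfl, rfl⟩
    · rw [traceCoeff_of_mem hi hj, hpd x hx]
      field_simp
    · rw [traceCoeff_of_mem hj hi, pd_comm hW hu hx, hpd x hx, ← (hT x hx).apply]
      field_simp
  · rw [hzero x hx A B hAB hs, zero_mul, eq_comm, mul_eq_zero]
    right
    by_cases hA : A ≠ i ∧ A ≠ j
    · exact (pd_pd_eq_zero hW hu (hk A hA.1 hA.2) hx B).2
    · by_cases hB : B ≠ i ∧ B ≠ j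
      · exact (pd_pd_eq_zero hW hu (hk B hB.1 hB.2) hx A).1
      · exfalso
        apply hs
        rw [Sym2.eq_iff]
        grind

/-- Mixed second derivatives of a function of a sum of functions of one variable each. -/
theorem pd_pd_comp_sum {u : (Fin n → ℝ) → ℝ} {W : Set (Fin n → ℝ)} (hW : IsOpen W)
    {S : Finset (Fin n)} {U : Fin n → ℝ → ℝ}
    (hU : ∀ j ∈ S, ContDiffOn ℝ 2 (U j) ((fun x : Fin n → ℝ => x j) '' W))
    {E E₁ E₂ : ℝ → ℝ} (hE : ∀ t, HasDerivAt E (E₁ t) t) (hE₁ : ∀ t, HasDerivAt E₁ (E₂ t) t)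
    (hu : ∀ x ∈ W, u x = E (∑ j ∈ S, U j (x j))) {x : Fin n → ℝ} (hx : x ∈ W)
    {A B : Fin n} (hAB : A ≠ B) :
    pd A (pd B u) x = E₂ (∑ j ∈ S, U j (x j)) *
      ((if A ∈ S then deriv (U A) (x A) else 0) * (if B ∈ S then deriv (U B) (x B) else 0)) := by
  have himg : ∀ j, IsOpen ((fun x : Fin n → ℝ => x j) '' W) := fun j => isOpenMap_eval j W hW
  have hd : ∀ j ∈ S, ∀ y ∈ W, HasDerivAt (U j) (deriv (U j) (y j)) (y j) := fun j hj y hy =>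
    (((hU j hj).differentiableOn (by norm_num)).differentiableAt
      ((himg j).mem_nhds ⟨y, hy, rfl⟩)).hasDerivAt
  have hd₂ : ∀ j ∈ S, ∀ y ∈ W, HasDerivAt (deriv (U j)) (deriv (deriv (U j)) (y j)) (y j) :=
    fun j hj y hy =>
    ((((hU j hj).deriv_of_isOpen (m := 1) (himg j) (by norm_num)).differentiableOn
      (by norm_num)).differentiableAt ((himg j).mem_nhds ⟨y, hy, rfl⟩)).hasDerivAt
  have hσ : ∀ y ∈ W, DifferentiableAt ℝ (fun y : Fin n → ℝ => ∑ j ∈ S, U j (y j)) y :=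
    fun y hy => DifferentiableAt.fun_sum fun j hj => differentiableAt_comp_apply (hd j hj y hy)
  have hpσ : ∀ k, ∀ y ∈ W, pd k (fun y : Fin n → ℝ => ∑ j ∈ S, U j (y j)) y =
      if k ∈ S then deriv (U k) (y k) else 0 := by
    intro k y hy
    rw [pd_sum S fun j hj => differentiableAt_comp_apply (hd j hj y hy),
      Finset.sum_congr rfl fun j hj => pd_comp_apply (hd j hj y hy), Finset.sum_ite_eq]
  have h1 : ∀ y ∈ W, pd B u y = E₁ (∑ j ∈ S, U j (y j)) *
      if B ∈ S then deriv (U B) (y B) else 0 := by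
    intro y hy
    rw [pd_congr_of_eqOn hW hu hy, pd_comp (hE _) (hσ y hy), hpσ B y hy]
  rw [pd_congr_of_eqOn hW h1 hx]
  by_cases hB : B ∈ S
  · simp only [if_pos hB]
    have hEd : DifferentiableAt ℝ (fun y : Fin n → ℝ => E₁ (∑ j ∈ S, U j (y j))) x :=
      (hE₁ _).differentiableAt.comp (g := E₁) x (hσ x hx)
    rw [pd_mul hEd (differentiableAt_comp_apply (hd₂ B hB x hx)), pd_comp (hE₁ _) (hσ x hx),
      hpσ A x hx, pd_comp_apply (hd₂ B hB x hx), if_neg hAB]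
    ring
  · simp [if_neg hB]

/-- The outer function `E` satisfies `E'' = E` in the exponential case and `E'' = -E` in the
trigonometric one, which matches the sign of `T_{ij}`. -/
theorem pd_pd_of_caseTwo {r : ℕ∞} (hr : 2 ≤ r) {D : Finset (Fin n)}
    {T : (Fin n → ℝ) → Matrix (Fin n) (Fin n) ℝ}
    {u : (Fin n → ℝ) → ℝ} {W : Set (Fin n → ℝ)} (hW : IsOpen W) (h : CaseTwo r D T u W) :
    ∀ x ∈ W, ∀ A B, A ≠ B → T x A B * u x = traceCoeff D A B * pd A (pd B u) x := by
  obtain ⟨S, hSD, -, hzero, U, hU, a, b, -, h⟩ := h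
  intro x hx A B hAB
  have hU2 : ∀ j ∈ S, ContDiffOn ℝ 2 (U j) ((fun x : Fin n → ℝ => x j) '' W) := fun j hj =>
    (hU j hj).1.of_le (WithTop.coe_le_coe.2 hr)
  rcases h with h | h
  · have h1 : ∀ c d t : ℝ, HasDerivAt (fun t => c * Real.exp t + d * Real.exp (-t))
        (c * Real.exp t + (-d) * Real.exp (-t)) t := fun c d t => by
      have := ((Real.hasDerivAt_exp t).const_mul c).fun_add
        (((hasDerivAt_neg t).exp).const_mul d)
      exact this.congr_deriv (by ring)
    rw [pd_pd_comp_sum hW hU2 (h1 a b) (h1 a (-b)) (fun y hy => (h y hy).2) hx hAB,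
      (h x hx).2]
    by_cases hS : A ∈ S ∧ B ∈ S
    · rw [(h x hx).1 A hS.1 B hS.2 hAB, traceCoeff_of_mem (hSD hS.1) (hSD hS.2), if_pos hS.1,
        if_pos hS.2]
      ring
    · rw [hzero x hx A B hAB hS]
      by_cases hA : A ∈ S
      · have hB : B ∉ S := fun hB => hS ⟨hA, hB⟩
        simp [hB]
      · simp [hA]
  · have h1 : ∀ c d t : ℝ, HasDerivAt (fun t => c * Real.cos t + d * Real.sin t)
        (d * Real.cos t + (-c) * Real.sin t) t := fun c d t => by
      have := ((Real.hasDerivAt_cos t).const_mul c).fun_add ((Real.hasDerivAt_sin t).const_mul d)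
      exact this.congr_deriv (by ring)
    rw [pd_pd_comp_sum hW hU2 (h1 a b) (h1 b (-a)) (fun y hy => (h y hy).2) hx hAB,
      (h x hx).2]
    by_cases hS : A ∈ S ∧ B ∈ S
    · rw [(h x hx).1 A hS.1 B hS.2 hAB, traceCoeff_of_mem (hSD hS.1) (hSD hS.2), if_pos hS.1,
        if_pos hS.2]
      ring
    · rw [hzero x hx A B hAB hS]
      by_cases hA : A ∈ S
      · have hB : B ∉ S := fun hB => hS ⟨hA, hB⟩
        simp [hB]
      · simp [hA]

theorem solvesOn_of_oneOfCases {r : ℕ∞} (hr : 2 ≤ r) {D : Finset (Fin n)} (hD₁ : 3 ≤ D.card)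
    (hD₂ : 3 ≤ Dᶜ.card) {T : (Fin n → ℝ) → Matrix (Fin n) (Fin n) ℝ}
    {u : (Fin n → ℝ) → ℝ} {W : Set (Fin n → ℝ)} (hW : IsOpen W) (hu : ContDiffOn ℝ 2 u W)
    (h0 : ∀ x ∈ W, u x ≠ 0) (hT : ∀ x ∈ W, (T x).IsSymm) (h : OneOfCases r D T u W) :
    SolvesOn D (flatConformal u) T W := by
  have hp₁ : (D.card : ℝ) ≠ 0 := by
    have : D.card ≠ 0 := by omega
    exact_mod_cast this
  have hp₂ : (Dᶜ.card : ℝ) ≠ 0 := by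
    have : Dᶜ.card ≠ 0 := by omega
    exact_mod_cast this
  obtain ⟨hd₁, hd₂, h | h⟩ := h
  · rw [solvesOn_flatConformal_iff hW hu h0]
    exact ⟨hd₁, hd₂, h.elim (pd_pd_of_caseOne hW hu hT hp₂) (pd_pd_of_caseTwo hr hW)⟩
  · rw [← solvesOn_compl, solvesOn_flatConformal_iff hW hu h0, compl_compl]
    exact ⟨hd₂, hd₁, h.elim (pd_pd_of_caseOne hW hu hT (by rwa [compl_compl]))
      (pd_pd_of_caseTwo hr hW)⟩

/-! ### Cubes, primitives and first-order systems -/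

/-- Finitely many continuous functions: on some smaller non-empty open set, each of them either
has no zero or vanishes identically. -/
theorem exists_open_forall_ne_or_eq_zero {X ι : Type*} [TopologicalSpace X] (s : Finset ι)
    (f : ι → X → ℝ) {O : Set X} (hO : IsOpen O) (hne : O.Nonempty)
    (hf : ∀ i ∈ s, ContinuousOn (f i) O) :
    ∃ O' ⊆ O, IsOpen O' ∧ O'.Nonempty ∧
      ∀ i ∈ s, (∀ x ∈ O', f i x ≠ 0) ∨ ∀ x ∈ O', f i x = 0 := by
  classical
  induction s using Finset.induction_on with
  | empty => exact ⟨O, subset_rfl, hO, hne, by simp⟩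
  | insert i s _ ih =>
    obtain ⟨O', hO'O, hO', hne', h⟩ := ih fun j hj => hf j (Finset.mem_insert_of_mem hj)
    by_cases hz : ∀ x ∈ O', f i x = 0
    · refine ⟨O', hO'O, hO', hne', fun j hj => ?_⟩
      rcases Finset.mem_insert.1 hj with rfl | hj
      · exact Or.inr hz
      · exact h j hj
    · push Not at hz
      obtain ⟨x, hx, hfx⟩ := hz
      refine ⟨O' ∩ f i ⁻¹' {0}ᶜ, Set.inter_subset_left.trans hO'O,
        ((hf i (Finset.mem_insert_self i s)).mono hO'O).isOpen_inter_preimage hO'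
          isOpen_compl_singleton, ⟨x, hx, hfx⟩, fun j hj => ?_⟩
      rcases Finset.mem_insert.1 hj with rfl | hj
      · exact Or.inl fun y hy => hy.2
      · exact (h j hj).imp (fun h y hy => h y hy.1) fun h y hy => h y hy.1

/-- Balls of the sup norm are cubes. This is what allows coordinates to be frozen or moved one at a
time without leaving the domain. -/
theorem mem_ball_pi {b : Fin n → ℝ} {ρ : ℝ} (hρ : 0 < ρ) {x : Fin n → ℝ} :
    x ∈ Metric.ball b ρ ↔ ∀ k, x k ∈ Metric.ball (b k) ρ := by
  rw [ball_pi b hρ, Set.mem_univ_pi]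

theorem update_mem_ball {b : Fin n → ℝ} {ρ : ℝ} (hρ : 0 < ρ) {x : Fin n → ℝ}
    (hx : x ∈ Metric.ball b ρ) {k : Fin n} {t : ℝ} (ht : t ∈ Metric.ball (b k) ρ) :
    Function.update x k t ∈ Metric.ball b ρ := by
  rw [mem_ball_pi hρ] at hx ⊢
  intro j
  by_cases h : j = k
  · subst h
    simpa using ht
  · simpa [h] using hx j

theorem exists_primitive {a : ℝ → ℝ} {c ρ : ℝ} (ha : ContinuousOn a (Metric.ball c ρ)) :
    ∃ U : ℝ → ℝ, ∀ t ∈ Metric.ball c ρ, HasDerivAt U (a t) t := by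
  refine ⟨fun t => ∫ s in c..t, a s, fun t ht => ?_⟩
  have hρ : 0 < ρ := Metric.pos_of_mem_ball ht
  have hsub : Set.uIcc c t ⊆ Metric.ball c ρ := by
    rw [← segment_eq_uIcc]
    exact (convex_ball c ρ).segment_subset (Metric.mem_ball_self hρ) ht
  exact intervalIntegral.integral_hasDerivAt_right (ha.mono hsub).intervalIntegrable
    (ha.stronglyMeasurableAtFilter Metric.isOpen_ball t ht)
    (ha.continuousAt (Metric.isOpen_ball.mem_nhds ht))

/-- The `a_i` come from first derivatives of `u` and have one order of smoothness less; their
primitives regain it. -/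
theorem contDiffOn_succ_of_hasDerivAt {k : ℕ∞} {U a : ℝ → ℝ} {I : Set ℝ} (hI : IsOpen I)
    (hU : ∀ t ∈ I, HasDerivAt U (a t) t) (ha : ContDiffOn ℝ k a I) :
    ContDiffOn ℝ ((k : WithTop ℕ∞) + 1) U I := by
  rw [contDiffOn_succ_iff_deriv_of_isOpen hI]
  refine ⟨fun t ht => (hU t ht).differentiableAt.differentiableWithinAt, by simp, ?_⟩
  exact ha.congr fun t ht => (hU t ht).deriv

/-- The system `du = m dσ`, `dm = u dσ` is diagonal in `u ± m`, and `(u ± m) exp(∓σ)` are constant.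
-/
theorem eq_exp_of_pd {B : Set (Fin n → ℝ)} (hB : Convex ℝ B) {u m σ : (Fin n → ℝ) → ℝ}
    (hu : ∀ x ∈ B, DifferentiableAt ℝ u x) (hm : ∀ x ∈ B, DifferentiableAt ℝ m x)
    (hσ : ∀ x ∈ B, DifferentiableAt ℝ σ x) (hpu : ∀ k, ∀ x ∈ B, pd k u x = m x * pd k σ x)
    (hpm : ∀ k, ∀ x ∈ B, pd k m x = u x * pd k σ x) :
    ∃ α β : ℝ, ∀ x ∈ B, u x = α * Real.exp (σ x) + β * Real.exp (-σ x) := by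
  rcases B.eq_empty_or_nonempty with rfl | ⟨b, hb⟩
  · exact ⟨0, 0, by simp⟩
  have key : ∀ ε : ℝ, ε ^ 2 = 1 → ∀ x ∈ B,
      (u x + ε * m x) * Real.exp (-ε * σ x) = (u b + ε * m b) * Real.exp (-ε * σ b) := by
    intro ε hε x hx
    have h1 : ∀ y ∈ B, DifferentiableAt ℝ (fun x => u x + ε * m x) y := fun y hy =>
      (hu y hy).fun_add ((hm y hy).const_mul ε)
    have h2 : ∀ t, HasDerivAt (fun t => Real.exp (-ε * t)) (-ε * Real.exp (-ε * t)) t := fun t => by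
      have := ((hasDerivAt_id t).const_mul (-ε)).exp
      simpa [mul_comm] using this
    have h3 : ∀ y ∈ B, DifferentiableAt ℝ (fun x => Real.exp (-ε * σ x)) y := fun y hy =>
      (h2 _).differentiableAt.comp (g := fun t => Real.exp (-ε * t)) y (hσ y hy)
    refine eq_of_pd_eq_zero (f := fun x => (u x + ε * m x) * Real.exp (-ε * σ x)) hB
      (fun y hy => (h1 y hy).fun_mul (h3 y hy)) hx hb fun k => Or.inr fun y hy => ?_
    rw [pd_mul (h1 y hy) (h3 y hy), pd_add (hu y hy) ((hm y hy).const_mul ε),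
      pd_const_mul ε (hm y hy), pd_comp (h2 _) (hσ y hy), hpu k y hy, hpm k y hy]
    linear_combination (-m y * pd k σ y * Real.exp (-ε * σ y)) * hε
  refine ⟨(u b + 1 * m b) * Real.exp (-1 * σ b) / 2,
    (u b + (-1) * m b) * Real.exp (-(-1) * σ b) / 2, fun x hx => ?_⟩
  rw [← key 1 (by norm_num) x hx, ← key (-1) (by norm_num) x hx]
  have h1 : Real.exp (σ x) * Real.exp (-σ x) = 1 := by rw [← Real.exp_add]; simp
  simp only [neg_mul, one_mul, neg_neg]
  linear_combination (-u x) * h1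

/-- Here `(u, m)` rotates with angle `σ`; undoing the rotation gives two constants, which are the
coefficients. -/
theorem eq_cos_of_pd {B : Set (Fin n → ℝ)} (hB : Convex ℝ B) {u m σ : (Fin n → ℝ) → ℝ}
    (hu : ∀ x ∈ B, DifferentiableAt ℝ u x) (hm : ∀ x ∈ B, DifferentiableAt ℝ m x)
    (hσ : ∀ x ∈ B, DifferentiableAt ℝ σ x) (hpu : ∀ k, ∀ x ∈ B, pd k u x = m x * pd k σ x)
    (hpm : ∀ k, ∀ x ∈ B, pd k m x = -(u x * pd k σ x)) :
    ∃ α β : ℝ, ∀ x ∈ B, u x = α * Real.cos (σ x) + β * Real.sin (σ x) := by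
  rcases B.eq_empty_or_nonempty with rfl | ⟨b, hb⟩
  · exact ⟨0, 0, by simp⟩
  have hc : ∀ y ∈ B, DifferentiableAt ℝ (fun x => Real.cos (σ x)) y := fun y hy => (hσ y hy).cos
  have hs : ∀ y ∈ B, DifferentiableAt ℝ (fun x => Real.sin (σ x)) y := fun y hy => (hσ y hy).sin
  have h1 : ∀ x ∈ B, u x * Real.cos (σ x) - m x * Real.sin (σ x) =
      u b * Real.cos (σ b) - m b * Real.sin (σ b) := by
    intro x hx
    refine eq_of_pd_eq_zero (f := fun x => u x * Real.cos (σ x) - m x * Real.sin (σ x)) hB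
      (fun y hy => ((hu y hy).fun_mul (hc y hy)).fun_sub ((hm y hy).fun_mul (hs y hy))) hx hb
      fun k => Or.inr fun y hy => ?_
    rw [pd_sub ((hu y hy).fun_mul (hc y hy)) ((hm y hy).fun_mul (hs y hy)),
      pd_mul (hu y hy) (hc y hy), pd_mul (hm y hy) (hs y hy),
      pd_comp (Real.hasDerivAt_cos _) (hσ y hy), pd_comp (Real.hasDerivAt_sin _) (hσ y hy),
      hpu k y hy, hpm k y hy]
    ring
  have h2 : ∀ x ∈ B, u x * Real.sin (σ x) + m x * Real.cos (σ x) =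
      u b * Real.sin (σ b) + m b * Real.cos (σ b) := by
    intro x hx
    refine eq_of_pd_eq_zero (f := fun x => u x * Real.sin (σ x) + m x * Real.cos (σ x)) hB
      (fun y hy => ((hu y hy).fun_mul (hs y hy)).fun_add ((hm y hy).fun_mul (hc y hy))) hx hb
      fun k => Or.inr fun y hy => ?_
    rw [pd_add ((hu y hy).fun_mul (hs y hy)) ((hm y hy).fun_mul (hc y hy)),
      pd_mul (hu y hy) (hs y hy), pd_mul (hm y hy) (hc y hy),
      pd_comp (Real.hasDerivAt_cos _) (hσ y hy), pd_comp (Real.hasDerivAt_sin _) (hσ y hy),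
      hpu k y hy, hpm k y hy]
    ring
  refine ⟨u b * Real.cos (σ b) - m b * Real.sin (σ b),
    u b * Real.sin (σ b) + m b * Real.cos (σ b), fun x hx => ?_⟩
  rw [← h1 x hx, ← h2 x hx]
  linear_combination (-u x) * Real.cos_sq_add_sin_sq (σ x)

/-! ### Integration of the Hessian system -/

/-- The system `u_{AB} = q_{AB} u` for `A ≠ B`, where `q_{AB}` depends on `x_A` and `x_B` only. -/
structure HessianSystem (q : Fin n → Fin n → (Fin n → ℝ) → ℝ) (u : (Fin n → ℝ) → ℝ)
    (B : Set (Fin n → ℝ)) : Prop where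
  isOpen : IsOpen B
  convex : Convex ℝ B
  contDiffOn : ContDiffOn ℝ 2 u B
  ne_zero : ∀ x ∈ B, u x ≠ 0
  coeff_differentiableAt : ∀ i j, i ≠ j → ∀ x ∈ B, DifferentiableAt ℝ (q i j) x
  pd_coeff : ∀ i j k, i ≠ j → k ≠ i → k ≠ j → ∀ x ∈ B, pd k (q i j) x = 0
  pd_pd : ∀ i j, i ≠ j → ∀ x ∈ B, pd i (pd j u) x = q i j x * u x

namespace HessianSystem

variable {q : Fin n → Fin n → (Fin n → ℝ) → ℝ} {u : (Fin n → ℝ) → ℝ} {B : Set (Fin n → ℝ)}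

theorem differentiableAt (h : HessianSystem q u B) {x : Fin n → ℝ} (hx : x ∈ B) :
    DifferentiableAt ℝ u x :=
  (h.contDiffOn.differentiableOn (by norm_num)).differentiableAt (h.isOpen.mem_nhds hx)

theorem differentiableAt_pd (h : HessianSystem q u B) {x : Fin n → ℝ} (hx : x ∈ B) (i : Fin n) :
    DifferentiableAt ℝ (pd i u) x :=
  ((contDiffOn_pd h.isOpen h.contDiffOn (k := 1) (by norm_num) i).differentiableOn
    (by norm_num)).differentiableAt (h.isOpen.mem_nhds hx)

theorem coeff_comm (h : HessianSystem q u B) {x : Fin n → ℝ} (hx : x ∈ B) {i j : Fin n}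
    (hij : i ≠ j) : q i j x = q j i x := by
  apply mul_right_cancel₀ (h.ne_zero x hx)
  rw [← h.pd_pd i j hij x hx, ← h.pd_pd j i hij.symm x hx, pd_comm h.isOpen h.contDiffOn hx]

theorem coeff_congr (h : HessianSystem q u B) {i j : Fin n} (hij : i ≠ j) {x y : Fin n → ℝ}
    (hx : x ∈ B) (hy : y ∈ B) (hi : x i = y i) (hj : x j = y j) : q i j x = q i j y :=
  eq_of_pd_eq_zero h.convex (h.coeff_differentiableAt i j hij) hx hy fun k => by
    by_cases hki : k = i
    · exact Or.inl (hki ▸ hi)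
    by_cases hkj : k = j
    · exact Or.inl (hkj ▸ hj)
    exact Or.inr (h.pd_coeff i j k hij hki hkj)

/-- The integrability condition obtained from the third derivatives. -/
theorem coeff_mul_pd (h : HessianSystem q u B) {x : Fin n → ℝ} (hx : x ∈ B) {i j k : Fin n}
    (hij : i ≠ j) (hik : i ≠ k) (hjk : j ≠ k) : q i j x * pd k u x = q i k x * pd j u x := by
  have hd : ∀ j, i ≠ j → DifferentiableAt ℝ (fun y => q j i y * u y) x := fun j hj =>
    (h.coeff_differentiableAt j i hj.symm x hx).fun_mul (h.differentiableAt hx)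
  -- `u` is only `C²`, but `u_{ji} = q_{ji} u` and `u_{ki} = q_{ki} u` are differentiable by the
  -- system itself, so the derivatives of `u_i` along `j` and `k` may be exchanged once more.
  have h1 := pd_comm_of_differentiableAt h.isOpen (fun y hy => h.differentiableAt_pd hy i)
    (h.pd_pd j i hij.symm) (h.pd_pd k i hik.symm) hx (hd j hij) (hd k hik)
  rw [pd_mul (h.coeff_differentiableAt j i hij.symm x hx) (h.differentiableAt hx),
    pd_mul (h.coeff_differentiableAt k i hik.symm x hx) (h.differentiableAt hx),
    h.pd_coeff j i k hij.symm hjk.symm hik.symm x hx,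
    h.pd_coeff k i j hik.symm hjk hij.symm x hx] at h1
  rw [h.coeff_comm hx hij, h.coeff_comm hx hik]
  linarith

/-- For `k ≠ i, j` the numerator of `∂_k (u_i / u_j)` is `u (q_{ki} u_j - q_{kj} u_i)`, which is
zero by `coeff_mul_pd`. -/
theorem pd_div_pd_congr (h : HessianSystem q u B) {i j : Fin n} (hij : i ≠ j)
    (hj : ∀ x ∈ B, pd j u x ≠ 0) {x y : Fin n → ℝ} (hx : x ∈ B) (hy : y ∈ B)
    (hxi : x i = y i) (hxj : x j = y j) : pd i u x / pd j u x = pd i u y / pd j u y := by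
  refine eq_of_pd_eq_zero (f := fun z => pd i u z / pd j u z) h.convex (fun z hz => ?_) hx hy
    fun k => ?_
  · simpa only [div_eq_mul_inv] using
      (h.differentiableAt_pd hz i).fun_mul ((h.differentiableAt_pd hz j).fun_inv (hj z hz))
  · by_cases hki : k = i
    · exact Or.inl (hki ▸ hxi)
    by_cases hkj : k = j
    · exact Or.inl (hkj ▸ hxj)
    refine Or.inr fun z hz => ?_
    rw [pd_div (h.differentiableAt_pd hz i) (h.differentiableAt_pd hz j) (hj z hz),
      h.pd_pd k i hki z hz, h.pd_pd k j hkj z hz]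
    have := h.coeff_mul_pd hz hki hkj hij
    rw [div_eq_zero_iff]
    left
    linear_combination u z * this

/-- The gradient is proportional to a vector whose components depend on one variable each. -/
theorem exists_separated {b : Fin n → ℝ} {ρ : ℝ} (h : HessianSystem q u (Metric.ball b ρ))
    (hρ : 0 < ρ) {k : ℕ∞} (hu : ContDiffOn ℝ ((k : WithTop ℕ∞) + 1) u (Metric.ball b ρ))
    {S : Finset (Fin n)} {e f g : Fin n} (he : e ∈ S) (hf : f ∈ S) (hg : g ∈ S)
    (hef : e ≠ f) (heg : e ≠ g) (hfg : f ≠ g)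
    (hS : ∀ i ∈ S, ∀ x ∈ Metric.ball b ρ, pd i u x ≠ 0) :
    ∃ a : Fin n → ℝ → ℝ, ∀ i ∈ S, ContDiffOn ℝ k (a i) (Metric.ball (b i) ρ) ∧
      (∀ t ∈ Metric.ball (b i) ρ, a i t ≠ 0) ∧
      ∀ x ∈ Metric.ball b ρ, pd i u x * a e (x e) = pd e u x * a i (x i) := by
  set B := Metric.ball b ρ with hB
  have hb : b ∈ B := Metric.mem_ball_self hρ
  let R : Fin n → Fin n → (Fin n → ℝ) → ℝ := fun i j x => pd i u x / pd j u x
  have hR0 : ∀ i ∈ S, ∀ j ∈ S, ∀ x ∈ B, R i j x ≠ 0 := fun i hi j hj x hx =>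
    div_ne_zero (hS i hi x hx) (hS j hj x hx)
  have hRm : ∀ i j l, l ∈ S → ∀ x ∈ B, R i j x = R i l x * R l j x := by
    intro i j l hl x hx
    have := hS l hl x hx
    simp only [R]
    field_simp
  have hRc : ∀ i j, i ≠ j → j ∈ S → ∀ x ∈ B, ∀ y ∈ B, x i = y i → x j = y j →
      R i j x = R i j y := fun i j hij hj x hx y hy h1 h2 =>
    h.pd_div_pd_congr hij (hS j hj) hx hy h1 h2
  have hco : ∀ x ∈ B, ∀ i, x i ∈ Metric.ball (b i) ρ := fun x hx => (mem_ball_pi hρ).1 hx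
  have hup : ∀ i, ∀ t ∈ Metric.ball (b i) ρ, Function.update b i t ∈ B := fun i t ht =>
    update_mem_ball hρ hb ht
  -- Factor `R_{ie} = R_{il} R_{le}` and freeze `x_l` at `b_l`, on which `R_{ie}` does not depend:
  -- one factor then involves `x_i` only and the other `x_e` only.
  have key : ∀ i ∈ S, ∀ l ∈ S, i ≠ e → l ≠ e → i ≠ l → ∀ x ∈ B,
      R i e x * R l e b = R i e (Function.update b i (x i)) * R l e (Function.update b e (x e)) := by
    intro i hi l hl hie hle hil x hx
    have hy : Function.update x l (b l) ∈ B :=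
      update_mem_ball hρ hx (Metric.mem_ball_self hρ)
    have hi' := hup i (x i) (hco x hx i)
    have he' := hup e (x e) (hco x hx e)
    rw [hRc i e hie he x hx _ hy (by simp [hil]) (by simp [hle.symm]), hRm i e l hl _ hy,
      hRm i e l hl _ hi',
      hRc i l hil hl _ hy _ hi' (by simp [hil]) (by simp [hil.symm]),
      hRc l e hle he _ hy _ he' (by simp [hle]) (by simp [hle.symm]),
      hRc l e hle he _ hi' _ hb (by simp [hil.symm]) (by simp [hie.symm])]
    ring
  -- The factor in `x_e` must be the same for every `i`, so the auxiliary index is fixed as `f`; for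
  -- `i = f` itself, `g` is used and then converted back to `f`.
  have key' : ∀ i ∈ S, i ≠ e → ∀ x ∈ B,
      R i e x * R f e b = R i e (Function.update b i (x i)) * R f e (Function.update b e (x e)) := by
    intro i hi hie x hx
    by_cases hif : i = f
    · subst hif
      have h1 := key i hi g hg hie heg.symm hfg x hx
      have h2 := key g hg i hi heg.symm hie hfg.symm _ (hup e (x e) (hco x hx e))
      have h3 : Function.update b g (Function.update b e (x e) g) = b := by
        rw [Function.update_of_ne heg.symm, Function.update_eq_self]
      rw [h3, Function.update_self] at h2
      apply mul_right_cancel₀ (hR0 g hg e he b hb)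
      linear_combination (R i e b) * h1 + R i e (Function.update b i (x i)) * h2
    · exact key i hi f hf hie hef.symm hif x hx
  have hsm : ∀ i j l, j ∈ S →
      ContDiffOn ℝ k (fun t => R i j (Function.update b l t)) (Metric.ball (b l) ρ) := by
    intro i j l hj
    have hm : Set.MapsTo (fun t => Function.update b l t) (Metric.ball (b l) ρ) B :=
      fun t ht => hup l t ht
    have h1 : ∀ i, ContDiffOn ℝ k (fun t => pd i u (Function.update b l t))
        (Metric.ball (b l) ρ) := fun i =>
      (contDiffOn_pd Metric.isOpen_ball hu le_rfl i).comp (contDiff_update _ b l).contDiffOn hm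
    exact (h1 i).div (h1 j) fun t ht => hS j hj _ (hm ht)
  -- By `key'`, `u_i / u_e` is a function of `x_i` times `R_{fe}(x_e) / R_{fe}(b)`; `a_e` is the
  -- reciprocal of the latter quotient.
  refine ⟨fun i t => if i = e then R f e b * R e f (Function.update b e t)
    else R i e (Function.update b i t), fun i hi => ?_⟩
  by_cases hie : i = e
  · subst hie
    simp only [if_true]
    exact ⟨contDiffOn_const.mul (hsm i f i hf), fun t ht =>
      mul_ne_zero (hR0 f hf i he b hb) (hR0 i he f hf _ (hup i t ht)), fun _ _ => trivial⟩
  · simp only [if_neg hie, if_true]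
    refine ⟨hsm i e i he, fun t ht => hR0 i hi e he _ (hup i t ht), fun x hx => ?_⟩
    have h1 := key' i hi hie x hx
    have h2 : R f e (Function.update b e (x e)) * R e f (Function.update b e (x e)) = 1 := by
      have hx' := hup e (x e) (hco x hx e)
      have h3 := hS e he _ hx'
      have h4 := hS f hf _ hx'
      simp only [R]
      field_simp
    have h3 : pd i u x = R i e x * pd e u x := (div_mul_cancel₀ _ (hS e he x hx)).symm
    rw [h3]
    linear_combination pd e u x * R e f (Function.update b e (x e)) * h1 +
      pd e u x * R i e (Function.update b i (x i)) * h2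

/-- If the gradient is `μ a_i(x_i)`, then the coefficients are products up to a constant, and `μ`
satisfies a first-order system. -/
theorem exists_coeff_eq_mul {b : Fin n → ℝ} {ρ : ℝ} (h : HessianSystem q u (Metric.ball b ρ))
    (hρ : 0 < ρ) {S : Finset (Fin n)} {e f g : Fin n} (he : e ∈ S) (hf : f ∈ S) (hg : g ∈ S)
    (hef : e ≠ f) (heg : e ≠ g) (hfg : f ≠ g)
    (hS : ∀ k, k ∉ S → ∀ x ∈ Metric.ball b ρ, pd k u x = 0)
    {a : Fin n → ℝ → ℝ} (ha : ∀ i ∈ S, DifferentiableOn ℝ (a i) (Metric.ball (b i) ρ))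
    (ha0 : ∀ i ∈ S, ∀ t ∈ Metric.ball (b i) ρ, a i t ≠ 0)
    (hau : ∀ i ∈ S, ∀ x ∈ Metric.ball b ρ, pd i u x * a e (x e) = pd e u x * a i (x i)) :
    ∃ (κ : ℝ) (μ : (Fin n → ℝ) → ℝ), (∀ x ∈ Metric.ball b ρ, DifferentiableAt ℝ μ x) ∧
      (∀ k, ∀ x ∈ Metric.ball b ρ, pd k u x = μ x * if k ∈ S then a k (x k) else 0) ∧
      (∀ k, ∀ x ∈ Metric.ball b ρ, pd k μ x = κ * u x * if k ∈ S then a k (x k) else 0) ∧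
      ∀ i ∈ S, ∀ j ∈ S, i ≠ j → ∀ x ∈ Metric.ball b ρ, q i j x = κ * (a i (x i) * a j (x j)) := by
  set B := Metric.ball b ρ with hB
  have hb : b ∈ B := Metric.mem_ball_self hρ
  have hco : ∀ x ∈ B, ∀ i, x i ∈ Metric.ball (b i) ρ := fun x hx => (mem_ball_pi hρ).1 hx
  have hax : ∀ i ∈ S, ∀ x ∈ B, a i (x i) ≠ 0 := fun i hi x hx => ha0 i hi _ (hco x hx i)
  have had : ∀ i ∈ S, ∀ x ∈ B, HasDerivAt (a i) (deriv (a i) (x i)) (x i) := fun i hi x hx =>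
    ((ha i hi).differentiableAt (Metric.isOpen_ball.mem_nhds (hco x hx i))).hasDerivAt
  have had' : ∀ i ∈ S, ∀ x ∈ B, DifferentiableAt ℝ (fun x : Fin n → ℝ => a i (x i)) x :=
    fun i hi x hx => differentiableAt_comp_apply (had i hi x hx)
  let μ : (Fin n → ℝ) → ℝ := fun x => pd e u x / a e (x e)
  have hμd : ∀ x ∈ B, DifferentiableAt ℝ μ x := fun x hx => by
    simpa only [μ, div_eq_mul_inv] using
      (h.differentiableAt_pd hx e).fun_mul ((had' e he x hx).fun_inv (hax e he x hx))
  have hμ : ∀ i ∈ S, ∀ x ∈ B, pd i u x = μ x * a i (x i) := fun i hi x hx => by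
    have := hau i hi x hx
    have h0 := hax e he x hx
    simp only [μ]
    field_simp
    linarith
  -- Differentiate `u_i = μ a_i(x_i)` along `j ≠ i`: only `μ` is differentiated.
  have hpμ : ∀ i ∈ S, ∀ j, j ≠ i → ∀ x ∈ B, q j i x * u x = pd j μ x * a i (x i) := by
    intro i hi j hji x hx
    rw [← h.pd_pd j i hji x hx, pd_congr_of_eqOn h.isOpen (hμ i hi) hx,
      pd_mul (hμd x hx) (had' i hi x hx), pd_comp_apply (had i hi x hx), if_neg hji]
    ring
  let ν : (Fin n → ℝ) → ℝ := fun x => q e f x / (a e (x e) * a f (x f))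
  have hν₀ : ∀ x ∈ B, q e f x = ν x * (a e (x e) * a f (x f)) := fun x hx =>
    (div_mul_cancel₀ _ (mul_ne_zero (hax e he x hx) (hax f hf x hx))).symm
  have hν₁ : ∀ i ∈ S, ∀ x ∈ B, pd i μ x = ν x * u x * a i (x i) := by
    have h1 : ∀ i ∈ S, ∀ j ∈ S, i ≠ j → ∀ x ∈ B, pd i μ x * a j (x j) = pd j μ x * a i (x i) := by
      intro i hi j hj hij x hx
      rw [← hpμ i hi j hij.symm x hx, ← hpμ j hj i hij x hx, h.coeff_comm hx hij]
    have h2 : ∀ x ∈ B, pd e μ x = ν x * u x * a e (x e) := by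
      intro x hx
      apply mul_right_cancel₀ (hax f hf x hx)
      rw [← hpμ f hf e hef x hx, hν₀ x hx]
      ring
    intro i hi x hx
    by_cases hie : i = e
    · subst hie
      exact h2 x hx
    · apply mul_right_cancel₀ (hax e he x hx)
      rw [h1 i hi e he hie x hx, h2 x hx]
      ring
  have hν : ∀ i ∈ S, ∀ j ∈ S, i ≠ j → ∀ x ∈ B, q i j x = ν x * (a i (x i) * a j (x j)) := by
    intro i hi j hj hij x hx
    apply mul_right_cancel₀ (h.ne_zero x hx)
    rw [hpμ j hj i hij x hx, hν₁ i hi x hx]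
    ring
  have hνc : ∀ i ∈ S, ∀ j ∈ S, i ≠ j → ∀ x ∈ B, ∀ y ∈ B, x i = y i → x j = y j → ν x = ν y := by
    intro i hi j hj hij x hx y hy h1 h2
    have h3 := h.coeff_congr hij hx hy h1 h2
    rw [hν i hi j hj hij x hx, hν i hi j hj hij y hy, h1, h2] at h3
    exact mul_right_cancel₀ (mul_ne_zero (hax i hi y hy) (hax j hj y hy)) h3
  -- `ν` is determined by the coordinates of any one pair from `S`. The pair `f, g` allows `x_e` to
  -- be reset, then `e, f` allows every coordinate but `x_f`, and `e, g` allows `x_f`.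
  have hνb : ∀ x ∈ B, ν x = ν b := by
    intro x hx
    have hy : Function.update x e (b e) ∈ B := update_mem_ball hρ hx (Metric.mem_ball_self hρ)
    have hz : Function.update b f (x f) ∈ B := update_mem_ball hρ hb (hco x hx f)
    rw [hνc f hf g hg hfg x hx _ hy (by simp [hef.symm]) (by simp [heg.symm]),
      hνc e he f hf hef _ hy _ hz (by simp [hef]) (by simp [hef.symm]),
      hνc e he g hg heg _ hz _ hb (by simp [hef]) (by simp [hfg.symm])]
  refine ⟨ν b, μ, hμd, fun k x hx => ?_, fun k x hx => ?_, fun i hi j hj hij x hx => ?_⟩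
  · by_cases hk : k ∈ S
    · rw [if_pos hk, hμ k hk x hx]
    · rw [if_neg hk, hS k hk x hx, mul_zero]
  · by_cases hk : k ∈ S
    · rw [if_pos hk, hν₁ k hk x hx, hνb x hx]
    · rw [if_neg hk, mul_zero]
      -- For `k ∉ S`, `u_k = 0` gives `u_{ke} = 0`, hence `μ_k a_e = 0`.
      have hke : k ≠ e := fun hke => hk (hke ▸ he)
      have h1 := hpμ e he k hke x hx
      rw [← h.pd_pd k e hke x hx, (pd_pd_eq_zero h.isOpen h.contDiffOn (hS k hk) hx e).2] at h1
      exact (mul_eq_zero.1 h1.symm).resolve_right (hax e he x hx)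
  · rw [hν i hi j hj hij x hx, hνb x hx]

/-- With `s = √|κ|`, `U_i' = s a_i`, `σ = ∑ U_j` and `m = μ / s`, the system for `u` and `μ` becomes
`du = m dσ`, `dm = ± u dσ` with the sign of `κ`. Moreover `κ ≠ 0`, since `q_{ef}` does not vanish at
the centre. -/
theorem exists_form {b : Fin n → ℝ} {ρ : ℝ} (h : HessianSystem q u (Metric.ball b ρ))
    (hρ : 0 < ρ) {k : ℕ∞} (hk : 1 ≤ k)
    (hu : ContDiffOn ℝ ((k : WithTop ℕ∞) + 1) u (Metric.ball b ρ))
    {S : Finset (Fin n)} {e f g : Fin n} (he : e ∈ S) (hf : f ∈ S) (hg : g ∈ S)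
    (hef : e ≠ f) (heg : e ≠ g) (hfg : f ≠ g)
    (hS : ∀ i ∈ S, ∀ x ∈ Metric.ball b ρ, pd i u x ≠ 0)
    (hS' : ∀ k, k ∉ S → ∀ x ∈ Metric.ball b ρ, pd k u x = 0) (hq : q e f b ≠ 0) :
    ∃ U : Fin n → ℝ → ℝ,
      (∀ j ∈ S, ContDiffOn ℝ ((k : WithTop ℕ∞) + 1) (U j) (Metric.ball (b j) ρ) ∧
        ∀ t ∈ Metric.ball (b j) ρ, deriv (U j) t ≠ 0) ∧
      ∃ α β : ℝ,
        ((∀ x ∈ Metric.ball b ρ,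
            (∀ i ∈ S, ∀ j ∈ S, i ≠ j → q i j x = deriv (U i) (x i) * deriv (U j) (x j)) ∧
            u x = α * Real.exp (∑ j ∈ S, U j (x j)) + β * Real.exp (-∑ j ∈ S, U j (x j))) ∨
         (∀ x ∈ Metric.ball b ρ,
            (∀ i ∈ S, ∀ j ∈ S, i ≠ j → q i j x = -(deriv (U i) (x i) * deriv (U j) (x j))) ∧
            u x = α * Real.cos (∑ j ∈ S, U j (x j)) + β * Real.sin (∑ j ∈ S, U j (x j)))) := by
  obtain ⟨a, ha⟩ := h.exists_separated hρ hu he hf hg hef heg hfg hS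
  have hk' : (k : WithTop ℕ∞) ≠ 0 := by
    have : k ≠ 0 := by
      rintro rfl
      exact absurd hk (by norm_num)
    exact_mod_cast this
  obtain ⟨κ, μ, hμd, hpu, hpμ, hqa⟩ := h.exists_coeff_eq_mul hρ he hf hg hef heg hfg hS'
    (fun i hi => (ha i hi).1.differentiableOn hk') (fun i hi => (ha i hi).2.1)
    (fun i hi => (ha i hi).2.2)
  set B := Metric.ball b ρ with hB
  have hb : b ∈ B := Metric.mem_ball_self hρ
  have hκ : κ ≠ 0 := by
    rintro rfl
    apply hq
    rw [hqa e he f hf hef b hb, zero_mul]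
  set s := √|κ| with hs
  have hs0 : s ≠ 0 := (Real.sqrt_pos.2 (abs_pos.2 hκ)).ne'
  have hs2 : s * s = |κ| := Real.mul_self_sqrt (abs_nonneg κ)
  have hco : ∀ x ∈ B, ∀ i, x i ∈ Metric.ball (b i) ρ := fun x hx => (mem_ball_pi hρ).1 hx
  have hex : ∀ i, ∃ U : ℝ → ℝ, i ∈ S → ∀ t ∈ Metric.ball (b i) ρ, HasDerivAt U (s * a i t) t := by
    intro i
    by_cases hi : i ∈ S
    · obtain ⟨U, hU⟩ := exists_primitive (a := fun t => s * a i t)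
        (continuousOn_const.mul (ha i hi).1.continuousOn)
      exact ⟨U, fun _ => hU⟩
    · exact ⟨0, fun h => absurd h hi⟩
  choose U hU using hex
  let σ : (Fin n → ℝ) → ℝ := fun x => ∑ j ∈ S, U j (x j)
  have hσd : ∀ x ∈ B, DifferentiableAt ℝ σ x := fun x hx => DifferentiableAt.fun_sum fun j hj =>
    differentiableAt_comp_apply (hU j hj _ (hco x hx j))
  have hpσ : ∀ k, ∀ x ∈ B, pd k σ x = s * if k ∈ S then a k (x k) else 0 := by
    intro k x hx
    rw [pd_sum S fun j hj => differentiableAt_comp_apply (hU j hj _ (hco x hx j)),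
      Finset.sum_congr rfl fun j hj => pd_comp_apply (hU j hj _ (hco x hx j)), Finset.sum_ite_eq]
    split_ifs <;> simp
  have hmd : ∀ x ∈ B, DifferentiableAt ℝ (fun x => s⁻¹ * μ x) x := fun x hx =>
    (hμd x hx).const_mul _
  have hpu' : ∀ k, ∀ x ∈ B, pd k u x = s⁻¹ * μ x * pd k σ x := by
    intro k x hx
    rw [hpσ k x hx, hpu k x hx]
    field_simp
  refine ⟨U, fun j hj => ⟨contDiffOn_succ_of_hasDerivAt Metric.isOpen_ball (hU j hj)
    (contDiffOn_const.mul (ha j hj).1), fun t ht => ?_⟩, ?_⟩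
  · rw [(hU j hj t ht).deriv]
    exact mul_ne_zero hs0 ((ha j hj).2.1 t ht)
  have hdU : ∀ i ∈ S, ∀ x ∈ B, deriv (U i) (x i) = s * a i (x i) := fun i hi x hx =>
    (hU i hi _ (hco x hx i)).deriv
  rcases lt_or_gt_of_ne hκ with hneg | hpos
  · rw [abs_of_neg hneg] at hs2
    obtain ⟨α, β, hαβ⟩ := eq_cos_of_pd h.convex (fun x hx => h.differentiableAt hx) hmd hσd hpu'
      fun k x hx => by
        rw [hpσ k x hx, pd_const_mul _ (hμd x hx), hpμ k x hx]
        field_simp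
        rw [pow_two, hs2]
        ring
    refine ⟨α, β, Or.inr fun x hx => ⟨fun i hi j hj hij => ?_, hαβ x hx⟩⟩
    rw [hqa i hi j hj hij x hx, hdU i hi x hx, hdU j hj x hx]
    linear_combination (a i (x i) * a j (x j)) * hs2
  · rw [abs_of_pos hpos] at hs2
    obtain ⟨α, β, hαβ⟩ := eq_exp_of_pd h.convex (fun x hx => h.differentiableAt hx) hmd hσd hpu'
      fun k x hx => by
        rw [hpσ k x hx, pd_const_mul _ (hμd x hx), hpμ k x hx]
        field_simp
        rw [pow_two, hs2]
    refine ⟨α, β, Or.inl fun x hx => ⟨fun i hi j hj hij => ?_, hαβ x hx⟩⟩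
    rw [hqa i hi j hj hij x hx, hdU i hi x hx, hdU j hj x hx]
    linear_combination (-(a i (x i) * a j (x j))) * hs2

end HessianSystem

/-! ### Solutions have the special form locally -/

/-- On a ball on which a component `T_{ij}` with `i ≠ j` in `D` has no zero, and each component
of the gradient of `u` has no zero or vanishes identically, one of the two cases occurs. -/
theorem caseOne_or_caseTwo {r : ℕ∞} (hr : 2 ≤ r) {D : Finset (Fin n)} (hD₁ : 3 ≤ D.card)
    (hD₂ : 3 ≤ Dᶜ.card) {T : (Fin n → ℝ) → Matrix (Fin n) (Fin n) ℝ} {u : (Fin n → ℝ) → ℝ}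
    {b : Fin n → ℝ} {ρ : ℝ} (hρ : 0 < ρ) (hu : ContDiffOn ℝ r u (Metric.ball b ρ))
    (h0 : ∀ x ∈ Metric.ball b ρ, u x ≠ 0)
    (hTC1 : ∀ A B, ContDiffOn ℝ 1 (fun x => T x A B) (Metric.ball b ρ))
    (hTpd : ∀ A B k, A ≠ B → k ≠ A → k ≠ B → ∀ x ∈ Metric.ball b ρ, pd k (fun x => T x A B) x = 0)
    (hTmix : ∀ x ∈ Metric.ball b ρ, ∀ A ∈ D, ∀ B ∈ Dᶜ, T x A B = 0)
    (hsol : ∀ x ∈ Metric.ball b ρ, ∀ A B, A ≠ B →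
      T x A B * u x = traceCoeff D A B * pd A (pd B u) x)
    {i j : Fin n} (hi : i ∈ D) (hj : j ∈ D) (hij : i ≠ j)
    (hT0 : ∀ x ∈ Metric.ball b ρ, T x i j ≠ 0)
    (hdich : ∀ k, (∀ x ∈ Metric.ball b ρ, pd k u x ≠ 0) ∨ ∀ x ∈ Metric.ball b ρ, pd k u x = 0) :
    CaseOne D T u (Metric.ball b ρ) ∨ CaseTwo r D T u (Metric.ball b ρ) := by
  classical
  have hr' : (2 : WithTop ℕ∞) ≤ r := WithTop.coe_le_coe.2 hr
  have hc0 : ∀ A B, traceCoeff D A B ≠ 0 := fun A B => (traceCoeff_pos hD₁ hD₂ A B).ne'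
  have hTd : ∀ A B, ∀ x ∈ Metric.ball b ρ, DifferentiableAt ℝ (fun x => T x A B) x :=
    fun A B x hx => ((hTC1 A B).differentiableOn (by norm_num)).differentiableAt
      (Metric.isOpen_ball.mem_nhds hx)
  have h : HessianSystem (fun A B x => (traceCoeff D A B)⁻¹ * T x A B) u (Metric.ball b ρ) :=
    { isOpen := Metric.isOpen_ball
      convex := convex_ball b ρ
      contDiffOn := hu.of_le hr'
      ne_zero := h0
      coeff_differentiableAt := fun A B _ x hx => (hTd A B x hx).const_mul _
      pd_coeff := fun A B k hAB hkA hkB x hx => by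
        rw [pd_const_mul _ (hTd A B x hx), hTpd A B k hAB hkA hkB x hx, mul_zero]
      pd_pd := fun A B hAB x hx => by
        rw [mul_assoc, hsol x hx A B hAB, inv_mul_cancel_left₀ (hc0 A B)] }
  have hb : b ∈ Metric.ball b ρ := Metric.mem_ball_self hρ
  let S : Finset (Fin n) := {k | ∀ x ∈ Metric.ball b ρ, pd k u x ≠ 0}
  have hS : ∀ k ∈ S, ∀ x ∈ Metric.ball b ρ, pd k u x ≠ 0 := fun k hk => by simpa [S] using hk
  have hS' : ∀ k, k ∉ S → ∀ x ∈ Metric.ball b ρ, pd k u x = 0 := fun k hk =>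
    (hdich k).resolve_left fun hk' => hk (by simpa [S] using hk')
  have hTS : ∀ x ∈ Metric.ball b ρ, ∀ A B, A ≠ B → ¬(A ∈ S ∧ B ∈ S) → T x A B = 0 := by
    intro x hx A B hAB hAS
    have h1 : pd A (pd B u) x = 0 := by
      by_cases hA : A ∈ S
      · exact (pd_pd_eq_zero h.isOpen h.contDiffOn (hS' B fun hB => hAS ⟨hA, hB⟩) hx A).1
      · exact (pd_pd_eq_zero h.isOpen h.contDiffOn (hS' A hA) hx B).2
    have h2 := hsol x hx A B hAB
    rw [h1, mul_zero] at h2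
    exact (mul_eq_zero.1 h2).resolve_right (h0 x hx)
  have hijS : i ∈ S ∧ j ∈ S := by
    by_contra hn
    exact hT0 b hb (hTS b hb i j hij hn)
  -- For `k ∈ S` outside `D`, `q_{ij} u_k = q_{ik} u_j = 0` because the mixed components of `T`
  -- vanish, yet both factors on the left are nonzero.
  have hSD : S ⊆ D := by
    intro k hk
    by_contra hkD
    have hik : i ≠ k := fun h => hkD (h ▸ hi)
    have hjk : j ≠ k := fun h => hkD (h ▸ hj)
    have h1 := h.coeff_mul_pd hb hij hik hjk
    simp only [hTmix b hb i hi k (by simpa using hkD), mul_zero, zero_mul] at h1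
    exact (mul_ne_zero (mul_ne_zero (inv_ne_zero (hc0 i j)) (hT0 b hb)) (hS k hk b hb)) h1
  by_cases hg : ∃ g ∈ S, i ≠ g ∧ j ≠ g
  · right
    obtain ⟨g, hg, hig, hjg⟩ := hg
    -- `k` is the smoothness of the gradient; for `r = ∞` it is again `∞`.
    obtain ⟨k, rfl⟩ : ∃ k : ℕ∞, r = k + 1 := by
      have h1 : (1 : ℕ∞) ≤ r := le_trans (by norm_num) hr
      exact ⟨r - 1, (tsub_add_cancel_of_le h1).symm⟩
    have hk : 1 ≤ k := by
      have h2 : (1 : ℕ∞) + 1 ≤ k + 1 := by simpa [one_add_one_eq_two] using hr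
      exact (ENat.add_le_add_iff_right (by simp)).1 h2
    obtain ⟨U, hU, α, β, hf⟩ := h.exists_form hρ hk hu hijS.1 hijS.2 hg hij hig hjg hS hS'
      (mul_ne_zero (inv_ne_zero (hc0 i j)) (hT0 b hb))
    refine ⟨S, hSD, ?_, hTS, U, fun l hl => ⟨(hU l hl).1.mono ?_, ?_⟩, α, β, ?_, ?_⟩
    · exact Finset.two_lt_card.2 ⟨i, hijS.1, j, hijS.2, g, hg, hij, hig, hjg⟩
    · rintro _ ⟨x, hx, rfl⟩
      exact (mem_ball_pi hρ).1 hx l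
    · by_contra! hn
      have h1 : U l =ᶠ[𝓝 (b l)] fun _ => U l (b l) := by
        filter_upwards [Metric.ball_mem_nhds (b l) hρ] with t ht
        simpa using hn _ (update_mem_ball hρ hb ht) b hb
      apply (hU l hl).2 (b l) (Metric.mem_ball_self hρ)
      rw [h1.deriv_eq, deriv_const]
    -- If both coefficients vanished, `u` would vanish at the centre.
    · by_contra hn
      have h1 : α = 0 := by nlinarith [sq_nonneg α, sq_nonneg β]
      have h2 : β = 0 := by nlinarith [sq_nonneg α, sq_nonneg β]
      subst h1 h2
      apply h0 b hb
      rcases hf with hf | hf <;> simpa using (hf b hb).2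
    · refine hf.imp (fun hf x hx => ⟨fun A hA B hB hAB => ?_, (hf x hx).2⟩)
        fun hf x hx => ⟨fun A hA B hB hAB => ?_, (hf x hx).2⟩
      · rw [← (hf x hx).1 A hA B hB hAB, ← traceCoeff_of_mem (hSD hA) (hSD hB),
          mul_inv_cancel_left₀ (hc0 A B)]
      · rw [← mul_neg, ← (hf x hx).1 A hA B hB hAB, ← traceCoeff_of_mem (hSD hA) (hSD hB),
          mul_inv_cancel_left₀ (hc0 A B)]
  · left
    push Not at hg
    have hgS : ∀ k, k ∈ S → k = i ∨ k = j := fun k hk => by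
      by_contra! hn
      exact hn.2 (hg k hk hn.1.symm).symm
    refine ⟨i, hi, j, hj, hij, ⟨b, hb, hT0 b hb⟩, fun x hx A B hAB hs => hTS x hx A B hAB ?_,
      -- All coordinates except `x_i, x_j` are frozen at the centre; they lie outside `S`, so `u` is
      -- unchanged.
      ⟨fun t t' => u (Function.update (Function.update b i t) j t'), fun x hx => ?_⟩,
      fun x hx => ?_⟩
    · rintro ⟨hA, hB⟩
      apply hs
      rw [Sym2.eq_iff]
      have := hgS A hA
      have := hgS B hB
      grind
    · have hco := (mem_ball_pi hρ).1 hx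
      refine eq_of_pd_eq_zero h.convex (fun y hy => h.differentiableAt hy) hx
        (update_mem_ball hρ (update_mem_ball hρ hb (hco i)) (hco j)) fun k => ?_
      by_cases hk : k ∈ S
      · left
        rcases hgS k hk with rfl | rfl
        · simp [hij]
        · simp
      · exact Or.inr (hS' k hk)
    · have h1 := h.pd_pd i j hij x hx
      rw [h1, traceCoeff_of_mem hi hj]
      ring

theorem exists_ball_caseOne_or_caseTwo {r : ℕ∞} (hr : 2 ≤ r) {D : Finset (Fin n)}
    (hD₁ : 3 ≤ D.card) (hD₂ : 3 ≤ Dᶜ.card) {T : (Fin n → ℝ) → Matrix (Fin n) (Fin n) ℝ}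
    {u : (Fin n → ℝ) → ℝ} {O : Set (Fin n → ℝ)} (hO : IsOpen O) (hu : ContDiffOn ℝ r u O)
    (h0 : ∀ x ∈ O, u x ≠ 0) (hTC1 : ∀ A B, ContDiffOn ℝ 1 (fun x => T x A B) O)
    (hTpd : ∀ A B k, A ≠ B → k ≠ A → k ≠ B → ∀ x ∈ O, pd k (fun x => T x A B) x = 0)
    (hTmix : ∀ x ∈ O, ∀ A ∈ D, ∀ B ∈ Dᶜ, T x A B = 0) (hsol : SolvesOn D (flatConformal u) T O)
    {i j : Fin n} (hi : i ∈ D) (hj : j ∈ D) (hij : i ≠ j) {x₀ : Fin n → ℝ} (hx₀ : x₀ ∈ O)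
    (hT0 : T x₀ i j ≠ 0) :
    ∃ b ρ, 0 < ρ ∧ Metric.ball b ρ ⊆ O ∧ T b i j ≠ 0 ∧
      (CaseOne D T u (Metric.ball b ρ) ∨ CaseTwo r D T u (Metric.ball b ρ)) := by
  have hu2 : ContDiffOn ℝ 2 u O := hu.of_le (WithTop.coe_le_coe.2 hr)
  -- The restriction to the set where `T_{ij} ≠ 0` comes first, so that the later shrinking for the
  -- gradient keeps `T` non-diagonal.
  have hO' : IsOpen (O ∩ (fun x => T x i j) ⁻¹' {0}ᶜ) :=
    (hTC1 i j).continuousOn.isOpen_inter_preimage hO isOpen_compl_singleton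
  obtain ⟨O', hO'O, hO'o, ⟨b, hb⟩, hd⟩ := exists_open_forall_ne_or_eq_zero Finset.univ
    (fun k => pd k u) hO' ⟨x₀, hx₀, hT0⟩ fun k _ =>
      ((contDiffOn_pd hO hu2 (k := 1) (by norm_num) k).continuousOn).mono Set.inter_subset_left
  obtain ⟨ρ, hρ, hball⟩ := Metric.isOpen_iff.1 hO'o b hb
  have hsub : Metric.ball b ρ ⊆ O := fun x hx => (hO'O (hball hx)).1
  refine ⟨b, ρ, hρ, hsub, (hO'O hb).2, ?_⟩
  have hsol' := ((solvesOn_flatConformal_iff hO hu2 h0 D T).1 hsol).2.2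
  exact caseOne_or_caseTwo hr hD₁ hD₂ hρ (hu.mono hsub) (fun x hx => h0 x (hsub hx))
    (fun A B => (hTC1 A B).mono hsub)
    (fun A B k hAB hkA hkB x hx => hTpd A B k hAB hkA hkB x (hsub hx))
    (fun x hx => hTmix x (hsub hx)) (fun x hx => hsol' x (hsub hx)) hi hj hij
    (fun x hx => (hO'O (hball hx)).2)
    fun k => (hd k (Finset.mem_univ k)).imp (fun h x hx => h x (hball hx))
      fun h x hx => h x (hball hx)

theorem exists_oneOfCases_of_solvesOn {r : ℕ∞} (hr : 2 ≤ r) {D : Finset (Fin n)}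
    (hD₁ : 3 ≤ D.card) (hD₂ : 3 ≤ Dᶜ.card) {T : (Fin n → ℝ) → Matrix (Fin n) (Fin n) ℝ}
    {u : (Fin n → ℝ) → ℝ} {O : Set (Fin n → ℝ)} (hO : IsOpen O) (hu : ContDiffOn ℝ r u O)
    (h0 : ∀ x ∈ O, u x ≠ 0) (hTC1 : ∀ A B, ContDiffOn ℝ 1 (fun x => T x A B) O)
    (hTsymm : ∀ x ∈ O, (T x).IsSymm)
    (f : Fin n → Fin n → ℝ → ℝ → ℝ)
    (hTf : ∀ x ∈ O, ∀ A B, A ≠ B → (A ∈ D ↔ B ∈ D) → T x A B = f A B (x A) (x B))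
    (hTmix : ∀ x ∈ O, ∀ A ∈ D, ∀ B ∈ Dᶜ, T x A B = 0)
    (hsol : SolvesOn D (flatConformal u) T O) (hnd : NonDiagonalOn T O) :
    ∃ W' ⊆ O, IsOpen W' ∧ IsConnected W' ∧ NonDiagonalOn T W' ∧ OneOfCases r D T u W' := by
  obtain ⟨x₀, hx₀, i, j, hij, hT0⟩ := hnd
  have hTmix' : ∀ x ∈ O, ∀ A ∈ Dᶜ, ∀ B ∈ D, T x A B = 0 := fun x hx A hA B hB => by
    rw [← (hTsymm x hx).apply, hTmix x hx B hB A hA]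
  have hTpd : ∀ A B k, A ≠ B → k ≠ A → k ≠ B → ∀ x ∈ O, pd k (fun x => T x A B) x = 0 := by
    intro A B k hAB hkA hkB x hx
    apply pd_eq_zero_of_eventually
    filter_upwards [hO.mem_nhds hx] with y hy hyx
    by_cases hA : A ∈ D <;> by_cases hB : B ∈ D
    · rw [hTf y hy A B hAB (by tauto), hTf x hx A B hAB (by tauto), hyx A hkA.symm, hyx B hkB.symm]
    · rw [hTmix y hy A hA B (by simpa), hTmix x hx A hA B (by simpa)]
    · rw [hTmix' y hy A (by simpa) B hB, hTmix' x hx A (by simpa) B hB]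
    · rw [hTf y hy A B hAB (by tauto), hTf x hx A B hAB (by tauto), hyx A hkA.symm, hyx B hkB.symm]
  obtain ⟨hd₁, hd₂, -⟩ := (solvesOn_flatConformal_iff hO
    (hu.of_le (WithTop.coe_le_coe.2 hr)) h0 D T).1 hsol
  have hsplit : ∃ b ρ, 0 < ρ ∧ Metric.ball b ρ ⊆ O ∧ T b i j ≠ 0 ∧
      ((CaseOne D T u (Metric.ball b ρ) ∨ CaseTwo r D T u (Metric.ball b ρ)) ∨
        (CaseOne Dᶜ T u (Metric.ball b ρ) ∨ CaseTwo r Dᶜ T u (Metric.ball b ρ))) := by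
    by_cases hi : i ∈ D <;> by_cases hj : j ∈ D
    · obtain ⟨b, ρ, hρ, hsub, hb, h⟩ := exists_ball_caseOne_or_caseTwo hr hD₁ hD₂ hO hu h0 hTC1 hTpd
        hTmix hsol hi hj hij hx₀ hT0
      exact ⟨b, ρ, hρ, hsub, hb, Or.inl h⟩
    · exact absurd (hTmix x₀ hx₀ i hi j (by simpa)) hT0
    · exact absurd (hTmix' x₀ hx₀ i (by simpa) j hj) hT0
    · obtain ⟨b, ρ, hρ, hsub, hb, h⟩ := exists_ball_caseOne_or_caseTwo hr hD₂
        (by rwa [compl_compl]) hO hu h0 hTC1 hTpd (by simpa only [compl_compl] using hTmix')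
        (solvesOn_compl.2 hsol) (by simpa using hi) (by simpa using hj) hij hx₀ hT0
      exact ⟨b, ρ, hρ, hsub, hb, Or.inr h⟩
  obtain ⟨b, ρ, hρ, hsub, hb, h⟩ := hsplit
  have hbm : b ∈ Metric.ball b ρ := Metric.mem_ball_self hρ
  exact ⟨Metric.ball b ρ, hsub, Metric.isOpen_ball,
    ⟨⟨b, hbm⟩, (convex_ball b ρ).isPreconnected⟩, ⟨b, hbm, i, j, hij, hb⟩,
    fun x hx => hd₁ x (hsub hx), fun x hx => hd₂ x (hsub hx), h⟩

end PartialRicci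

end

/-! ### The theorem for the conformal factor `φ`, with `u = φ F` -/

open PartialRicci in
theorem theorem4 {n : ℕ} (D : Finset (Fin n)) (hD₁ : 3 ≤ D.card) (hD₂ : 3 ≤ Dᶜ.card)
    (r : ℕ∞) (hr : 2 ≤ r)
    (V : Set (Fin n → ℝ)) (hV : IsOpen V)
    (F : (Fin n → ℝ) → ℝ) (hF : ContDiffOn ℝ r F V) (hFpos : ∀ x ∈ V, 0 < F x)
    (T : (Fin n → ℝ) → Matrix (Fin n) (Fin n) ℝ)
    (hTC1 : ∀ A B, ContDiffOn ℝ 1 (fun x => T x A B) V)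
    (hTsymm : ∀ x ∈ V, (T x).IsSymm)
    (f : Fin n → Fin n → ℝ → ℝ → ℝ)
    (hTf : ∀ x ∈ V, ∀ A B, A ≠ B → (A ∈ D ↔ B ∈ D) → T x A B = f A B (x A) (x B))
    (hTmix : ∀ x ∈ V, ∀ A ∈ D, ∀ B ∈ Dᶜ, T x A B = 0)
    (hTnd : NonDiagonalOn T V) :
    -- existence of a solution on an open connected subset is equivalent to the two cases
    ((∃ W ⊆ V, IsOpen W ∧ IsConnected W ∧ NonDiagonalOn T W ∧
        ∃ φ : (Fin n → ℝ) → ℝ, ContDiffOn ℝ r φ W ∧ (∀ x ∈ W, φ x ≠ 0) ∧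
          SolvesOn D (conformal (flatConformal F) φ) T W) ↔
      (∃ W ⊆ V, IsOpen W ∧ IsConnected W ∧ NonDiagonalOn T W ∧
        ∃ φ : (Fin n → ℝ) → ℝ, ContDiffOn ℝ r φ W ∧ (∀ x ∈ W, φ x ≠ 0) ∧
          OneOfCases r D T (fun x => φ x * F x) W)) ∧
    -- every solution has this form, locally near a dense set of points where `T` is not diagonal
    (∀ W ⊆ V, IsOpen W → ∀ φ : (Fin n → ℝ) → ℝ, ContDiffOn ℝ r φ W → (∀ x ∈ W, φ x ≠ 0) →
      SolvesOn D (conformal (flatConformal F) φ) T W →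
      ∀ O ⊆ W, IsOpen O → NonDiagonalOn T O →
        ∃ W' ⊆ O, IsOpen W' ∧ IsConnected W' ∧ NonDiagonalOn T W' ∧
          OneOfCases r D T (fun x => φ x * F x) W') ∧
    -- every function of this form is a solution
    (∀ W ⊆ V, IsOpen W → ∀ φ : (Fin n → ℝ) → ℝ, ContDiffOn ℝ r φ W → (∀ x ∈ W, φ x ≠ 0) →
      OneOfCases r D T (fun x => φ x * F x) W →
      SolvesOn D (conformal (flatConformal F) φ) T W) := by
  have hr' : (2 : WithTop ℕ∞) ≤ r := WithTop.coe_le_coe.2 hr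
  have hu : ∀ W ⊆ V, ∀ φ : (Fin n → ℝ) → ℝ, ContDiffOn ℝ r φ W →
      ContDiffOn ℝ r (fun x => φ x * F x) W := fun W hWV φ hφ => hφ.mul (hF.mono hWV)
  have h0 : ∀ W ⊆ V, ∀ φ : (Fin n → ℝ) → ℝ, (∀ x ∈ W, φ x ≠ 0) → ∀ x ∈ W, φ x * F x ≠ 0 :=
    fun W hWV φ hφ x hx => mul_ne_zero (hφ x hx) (hFpos x (hWV hx)).ne'
  have hforward : ∀ W ⊆ V, IsOpen W → ∀ φ : (Fin n → ℝ) → ℝ, ContDiffOn ℝ r φ W →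
      (∀ x ∈ W, φ x ≠ 0) → SolvesOn D (conformal (flatConformal F) φ) T W →
      ∀ O ⊆ W, IsOpen O → NonDiagonalOn T O →
        ∃ W' ⊆ O, IsOpen W' ∧ IsConnected W' ∧ NonDiagonalOn T W' ∧
          OneOfCases r D T (fun x => φ x * F x) W' := by
    intro W hWV _ φ hφ hφ0 hsol O hOW hO hnd
    rw [conformal_flatConformal] at hsol
    have hOV := hOW.trans hWV
    exact exists_oneOfCases_of_solvesOn hr hD₁ hD₂ hO (hu O hOV φ (hφ.mono hOW))
      (h0 O hOV φ fun x hx => hφ0 x (hOW hx)) (fun A B => (hTC1 A B).mono hOV)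
      (fun x hx => hTsymm x (hOV hx)) f (fun x hx => hTf x (hOV hx))
      (fun x hx => hTmix x (hOV hx)) (fun x hx => hsol x (hOW hx)) hnd
  have hconverse : ∀ W ⊆ V, IsOpen W → ∀ φ : (Fin n → ℝ) → ℝ, ContDiffOn ℝ r φ W →
      (∀ x ∈ W, φ x ≠ 0) → OneOfCases r D T (fun x => φ x * F x) W →
      SolvesOn D (conformal (flatConformal F) φ) T W := by
    intro W hWV hW φ hφ hφ0 h
    rw [conformal_flatConformal]
    exact solvesOn_of_oneOfCases hr hD₁ hD₂ hW ((hu W hWV φ hφ).of_le hr') (h0 W hWV φ hφ0)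
      (fun x hx => hTsymm x (hWV hx)) h
  refine ⟨⟨?_, ?_⟩, hforward, hconverse⟩
  · rintro ⟨W, hWV, hW, -, hnd, φ, hφ, hφ0, hsol⟩
    obtain ⟨W', hW'W, hW', hc, hnd', h⟩ := hforward W hWV hW φ hφ hφ0 hsol W subset_rfl hW hnd
    exact ⟨W', hW'W.trans hWV, hW', hc, hnd', φ, hφ.mono hW'W, fun x hx => hφ0 x (hW'W hx), h⟩
  · rintro ⟨W, hWV, hW, hc, hnd, φ, hφ, hφ0, h⟩
    exact ⟨W, hWV, hW, hc, hnd, φ, hφ, hφ0, hconverse W hWV hW φ hφ hφ0 h⟩
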